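/- Let $A$ be an AW*-algebra, that is, a (unital, complex) C*-algebra in which the right annihilator $\{x\in A : sx=0 \text{ for all } s\in S\}$ of every subset $S\subseteq A$ is of the form $pA$ for some projection $p=p^2=p^*\in A$. For projections $e,f\in A$ write $e\le f$ if $e=ef$, and $e\sim f$ if there is $v\in A$ with $e=vv^*$ and $f=v^*v$. A projection $e$ is finite if $e\sim f\le e$ implies $e=f$ for every projection $f\in A$, and infinite otherwise; a nonzero projection $e$ is properly infinite if for every central projection $z\in A$ the projection $ze$ is either zero or infinite. Let $C$ be a maximal abelian subalgebra of $A$ (a commutative $*$-subalgebra that is maximal with respect to inclusion), and suppose that every nonzero projection of $C$ is properly infinite in $A$. Then: (a) If $A\neq 0$, there are projections $e,p\in C$ with $0<e\le p$ and $e\sim p\sim p-e$. (b) There is a projection $e\in C$ with $e\sim 1\sim 1-e$. -/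

import Mathlib

/-- A (unital, complex) C⋆-algebra `A` is an AW⋆-algebra if the right annihilator of every subset
of `A` is the right ideal `p A` generated by a single projection `p`. -/
class IsAWStarAlgebra (A : Type*) [CStarAlgebra A] : Prop where
  exists_annihilator_eq : ∀ S : Set A, ∃ p : A, IsStarProjection p ∧
    {x : A | ∀ s ∈ S, s * x = 0} = {x : A | ∃ a : A, x = p * a}

namespace AWStar

variable {A : Type*} [CStarAlgebra A]

/-- `C` is a maximal abelian (self-adjoint) subalgebra of `A`: it is maximal, with respect to
inclusion, among the commutative ⋆-subalgebras of `A`. -/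
def IsMaximalAbelian (C : StarSubalgebra ℂ A) : Prop :=
  Maximal (fun B : StarSubalgebra ℂ A => ∀ x ∈ B, ∀ y ∈ B, x * y = y * x) C

/-- The order on projections: `e ≤ f` if and only if `e = e f`. -/
def ProjLE (e f : A) : Prop := e = e * f

/-- (Murray–von Neumann) equivalence of projections in `A`: `e = v v⋆` and `f = v⋆ v` for some
`v` in `A`. -/
def ProjEquiv (e f : A) : Prop := ∃ v : A, e = v * star v ∧ f = star v * v

/-- A projection `e` is finite if `e ∼ f ≤ e` implies `e = f`, for all projections `f`. -/
def IsFiniteProj (e : A) : Prop :=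
  ∀ f : A, IsStarProjection f → ProjEquiv e f → ProjLE f e → e = f

/-- A nonzero projection `e` is properly infinite if, for every central projection `z` of `A`,
the projection `z e` is either zero or infinite (that is, not finite). -/
structure IsProperlyInfinite (e : A) : Prop where
  isStarProjection : IsStarProjection e
  ne_zero : e ≠ 0
  eq_zero_or_infinite : ∀ z : A, IsStarProjection z → (∀ a : A, z * a = a * z) →
    z * e = 0 ∨ ¬ IsFiniteProj (z * e)

end AWStar

/-! Proper infiniteness is used only with the central projection `1`: every nonzero projection of
`C` is infinite. By Schröder–Bernstein (`Sub.antisymm`) it suffices to find `e ≤ p` in `C` with `p ≲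
e` and `p ≲ p - e`. On a central cut an infinite projection contains two orthogonal copies of itself
(`exists_central_halved`), but these need not lie in `C`; the work is to find them there.

Fix a halved `Q` in `C` and suppose that nothing below `Q` splits in `C`. An infinite `q ∈ C` has a
noncommutative corner, hence some `f ≤ q` in `C` with `f A (q - f) ≠ 0`. Comparability and halving
then give `e ≤ p` in `C`, with `p` a central cut of `q`, such that `p ≲ p - e` on every central cut.
As nothing splits, `p ≲ e` fails on every central cut meeting `e`: this is a `StrictPair`. After a
further cut, `p` contains infinitely many orthogonal copies of `e`, indexed by `J`, and is covered
by `Option J` pieces dominated by `e` (`exists_strictPair_cover`).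

Now take a strict pair `(p, e)` whose cover, indexed by `I`, has least cardinality, and apply the
construction inside `e`: some `z e` is covered by `Option J` pieces dominated by `e₂` and contains
`J` copies of `e₂`. Minimality gives `|I| ≤ |J|`, so `z e` has room for `I` orthogonal projections
each dominating `z e`, hence for all the pieces of `z p`. Thus `z p ≲ z e`, contradicting
strictness. This proves (a); for (b), a maximal orthogonal family of split projections has supremum
`1`, and the splittings are added up.

Partial isometries are added by `sub_of_isSup_of_mul_eq_zero`, which needs orthogonal suprema. That
is why `Q` is taken halved: below it the restriction disappears (`sub_of_isSup_of_halved`). -/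

namespace AWStar

/-! ### Subequivalence, suprema of projections and orthogonal additivity. -/

section Algebraic

variable {A : Type*} [CStarAlgebra A]

theorem mul_mul_of_mul_eq {a b c : A} (h : a * b = c) (x : A) : a * (b * x) = c * x := by
  rw [← mul_assoc, h]

theorem _root_.IsStarProjection.mul_self {e : A} (he : IsStarProjection e) : e * e = e :=
  he.isIdempotentElem

theorem _root_.IsStarProjection.star_eq {e : A} (he : IsStarProjection e) : star e = e :=
  he.isSelfAdjoint

theorem isStarProjection_of {e : A} (h : e * e = e) (h' : star e = e) : IsStarProjection e :=
  ⟨h, h'⟩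

/-- `e ≲ f`: there is a partial isometry with initial projection `e` and range below `f`. -/
def Sub (e f : A) : Prop := ∃ v : A, star v * v = e ∧ f * v = v

/-- `f` contains two orthogonal copies of itself. -/
def Halved (f : A) : Prop :=
  ∃ s t : A, star s * s = f ∧ star t * t = f ∧ star s * t = 0 ∧ f * s = s ∧ f * t = t

theorem star_mul_eq {a b c : A} (h : a * b = c) : star b * star a = star c := by
  rw [← star_mul, h]

theorem mul_comm_of_mul_eq_left {e f : A} (he : IsStarProjection e) (hf : IsStarProjection f)
    (h : e * f = e) : f * e = e := by
  simpa [he.star_eq, hf.star_eq] using star_mul_eq h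

theorem mul_eq_zero_comm {e f : A} (he : IsStarProjection e) (hf : IsStarProjection f)
    (h : e * f = 0) : f * e = 0 := by
  simpa [he.star_eq, hf.star_eq] using star_mul_eq h

theorem eq_of_star_sub_mul_sub {x y : A} (h : star (x - y) * (x - y) = 0) : x = y :=
  sub_eq_zero.mp (CStarRing.star_mul_self_eq_zero_iff _ |>.mp h)

theorem mul_eq_self_of_star_mul_self {v e : A} (he : IsStarProjection e) (h : star v * v = e) :
    v * e = v := by
  apply eq_of_star_sub_mul_sub
  simp only [star_sub, star_mul, he.star_eq, sub_mul, mul_sub, mul_assoc, h,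
    mul_mul_of_mul_eq h, he.mul_self]
  simp

theorem isStarProjection_mul_star {v e : A} (he : IsStarProjection e) (h : star v * v = e) :
    IsStarProjection (v * star v) := by
  refine isStarProjection_of ?_ (by simp)
  have h1 := mul_eq_self_of_star_mul_self he h
  rw [mul_assoc, mul_mul_of_mul_eq h, ← mul_assoc, h1]

theorem isStarProjection_sub {e f : A} (he : IsStarProjection e) (hf : IsStarProjection f)
    (h : e * f = e) : IsStarProjection (f - e) := by
  have h' := mul_comm_of_mul_eq_left he hf h
  refine isStarProjection_of ?_ (by simp [he.star_eq, hf.star_eq])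
  simp [sub_mul, mul_sub, h, h', he.mul_self, hf.mul_self]

theorem isStarProjection_add {e f : A} (he : IsStarProjection e) (hf : IsStarProjection f)
    (h : e * f = 0) : IsStarProjection (e + f) := by
  have h' := mul_eq_zero_comm he hf h
  refine isStarProjection_of ?_ (by simp [he.star_eq, hf.star_eq])
  simp [add_mul, mul_add, h, h', he.mul_self, hf.mul_self]

theorem isStarProjection_mul {e f : A} (he : IsStarProjection e) (hf : IsStarProjection f)
    (h : e * f = f * e) : IsStarProjection (e * f) := by
  refine isStarProjection_of ?_ (by simp [he.star_eq, hf.star_eq, h])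
  calc e * f * (e * f) = e * (f * e) * f := by simp only [mul_assoc]
    _ = e * f := by rw [← h, ← mul_assoc, he.mul_self, mul_assoc, hf.mul_self]

theorem Sub.of_le {e f : A} (he : IsStarProjection e) (hf : IsStarProjection f)
    (h : e * f = e) : Sub e f :=
  ⟨e, by rw [he.star_eq, he.mul_self], mul_comm_of_mul_eq_left he hf h⟩

theorem Sub.trans {e f g : A} (h : Sub e f) (h' : Sub f g) : Sub e g := by
  obtain ⟨v, hv, hv'⟩ := h
  obtain ⟨w, hw, hw'⟩ := h'
  refine ⟨w * v, ?_, by rw [← mul_assoc, hw']⟩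
  rw [star_mul, mul_assoc, mul_mul_of_mul_eq hw, hv', hv]

theorem Sub.mono_right {e f g : A} (h : Sub e f) (hf : IsStarProjection f)
    (hg : IsStarProjection g) (hfg : f * g = f) : Sub e g :=
  h.trans (Sub.of_le hf hg hfg)

theorem Sub.eq_zero {e : A} (h : Sub e 0) : e = 0 := by
  obtain ⟨v, hv, hv'⟩ := h
  rw [← hv, ← hv', zero_mul, mul_zero]

theorem Sub.central_mul {e f z : A} (h : Sub e f) (hz : IsStarProjection z)
    (hzc : ∀ a : A, z * a = a * z) : Sub (z * e) (z * f) := by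
  obtain ⟨v, hv, hv'⟩ := h
  refine ⟨z * v, ?_, ?_⟩
  · rw [star_mul, hz.star_eq, mul_assoc, mul_mul_of_mul_eq hz.mul_self, ← mul_assoc, ← hzc,
      mul_assoc, hv]
  · calc z * f * (z * v) = z * (f * z) * v := by simp only [mul_assoc]
      _ = z * v := by rw [← hzc, ← mul_assoc, hz.mul_self, mul_assoc, hv']

theorem Sub.add {e₁ e₂ f₁ f₂ : A} (h₁ : Sub e₁ f₁) (h₂ : Sub e₂ f₂) (hf₁ : IsStarProjection f₁)
    (hf₂ : IsStarProjection f₂) (hf : f₁ * f₂ = 0) : Sub (e₁ + e₂) (f₁ + f₂) := by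
  obtain ⟨v, hv, hv'⟩ := h₁
  obtain ⟨w, hw, hw'⟩ := h₂
  have hvw : star v * w = 0 := by
    rw [← hv', ← hw', star_mul, hf₁.star_eq, mul_assoc, mul_mul_of_mul_eq hf]; simp
  have hwv : star w * v = 0 := by simpa using star_mul_eq hvw
  have h1 : f₁ * w = 0 := by rw [← hw', mul_mul_of_mul_eq hf, zero_mul]
  have h2 : f₂ * v = 0 := by
    rw [← hv', mul_mul_of_mul_eq (mul_eq_zero_comm hf₁ hf₂ hf), zero_mul]
  exact ⟨v + w, by simp [add_mul, mul_add, hv, hw, hvw, hwv],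
    by simp [add_mul, mul_add, hv', hw', h1, h2]⟩

/-- `s` is the supremum of the family of projections `e`. -/
structure IsSup {ι : Type*} (e : ι → A) (s : A) : Prop where
  isStarProjection : IsStarProjection s
  mul_eq : ∀ i, e i * s = e i
  mul_eq_zero : ∀ x : A, (∀ i, e i * x = 0) → s * x = 0

variable {ι κ : Type*}

theorem IsSup.mul_eq_of_forall {e : ι → A} {s x y : A} (hs : IsSup e s)
    (h : ∀ i, e i * x = e i * y) : s * x = s * y := by
  have := hs.mul_eq_zero (x - y) fun i => by rw [mul_sub, h, sub_self]
  rwa [mul_sub, sub_eq_zero] at this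

theorem IsSup.le {e : ι → A} {s g : A} (hs : IsSup e s) (h : ∀ i, e i * g = e i) : s * g = s := by
  have := hs.mul_eq_of_forall (x := g) (y := 1) (by simpa using h)
  rwa [mul_one] at this

theorem IsSup.mul_left {e : ι → A} {s : A} (hs : IsSup e s) (he : ∀ i, IsStarProjection (e i))
    (i : ι) : s * e i = e i :=
  mul_comm_of_mul_eq_left (he i) hs.isStarProjection (hs.mul_eq i)

theorem IsSup.central_mul {e : ι → A} {s z : A} (hs : IsSup e s) (hz : IsStarProjection z)
    (hzc : ∀ a : A, z * a = a * z) : IsSup (fun i => z * e i) (z * s) where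
  isStarProjection := isStarProjection_mul hz hs.isStarProjection (hzc s)
  mul_eq i := by
    rw [hzc s, ← mul_assoc, mul_assoc z, hs.mul_eq, mul_assoc, ← hzc, ← mul_assoc, hz.mul_self]
  mul_eq_zero x h := by
    rw [hzc s, mul_assoc]
    refine hs.mul_eq_zero _ fun i => ?_
    rw [← mul_assoc, ← hzc]; exact h i

theorem IsSup.mul_eq_zero_of_forall {e : ι → A} {f : κ → A} {s t : A} (hs : IsSup e s)
    (ht : IsSup f t) (he : ∀ i, IsStarProjection (e i)) (hf : ∀ i, IsStarProjection (f i))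
    (h : ∀ i j, e i * f j = 0) : s * t = 0 := by
  refine hs.mul_eq_zero _ fun i => ?_
  refine mul_eq_zero_comm ht.isStarProjection (he i) (ht.mul_eq_zero _ fun j => ?_)
  exact mul_eq_zero_comm (he i) (hf j) (h i j)

theorem IsSup.comp_equiv {e : ι → A} {s : A} (φ : κ ≃ ι) (hs : IsSup e s) :
    IsSup (e ∘ φ) s where
  isStarProjection := hs.isStarProjection
  mul_eq _ := hs.mul_eq _
  mul_eq_zero x h := hs.mul_eq_zero x fun i => by simpa using h (φ.symm i)

/-- Conjugating a family below `q` by an isometry of `q`. -/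
theorem IsSup.conj {e : ι → A} {s q u : A} (hs : IsSup e s) (he : ∀ i, IsStarProjection (e i))
    (hq : IsStarProjection q) (hsq : s * q = s) (hu : star u * u = q) :
    IsSup (fun i => u * e i * star u) (u * s * star u) := by
  have hqs := mul_comm_of_mul_eq_left hs.isStarProjection hq hsq
  have hus : star u * (u * s) = s := by rw [mul_mul_of_mul_eq hu, hqs]
  have hue : ∀ i, star u * (u * e i) = e i := fun i => by
    rw [← hs.mul_left he, mul_mul_of_mul_eq hu, mul_mul_of_mul_eq hqs]
  refine ⟨isStarProjection_of ?_ ?_, fun i => ?_, fun x hx => ?_⟩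
  · calc u * s * star u * (u * s * star u) = u * s * (star u * (u * s)) * star u := by
          simp only [mul_assoc]
      _ = u * s * star u := by rw [hus, mul_assoc u, hs.isStarProjection.mul_self]
  · simp [hs.isStarProjection.star_eq, mul_assoc]
  · calc u * e i * star u * (u * s * star u) = u * e i * (star u * (u * s)) * star u := by
          simp only [mul_assoc]
      _ = u * e i * star u := by rw [hus, mul_assoc u, hs.mul_eq]
  · have : s * (star u * x) = 0 := hs.mul_eq_zero _ fun i => by
      calc e i * (star u * x) = star u * (u * e i) * (star u * x) := by rw [hue]
        _ = star u * (u * e i * star u * x) := by simp only [mul_assoc]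
        _ = 0 := by rw [hx i, mul_zero]
    rw [mul_assoc, mul_assoc, this, mul_zero]

theorem isSup_option {e : ι → A} {s r : A} (hs : IsSup e s)
    (hr : IsStarProjection r) (h : s * r = 0) :
    IsSup (fun o : Option ι => o.elim r e) (s + r) where
  isStarProjection := isStarProjection_add hs.isStarProjection hr h
  mul_eq
    | none => by simp [mul_add, mul_eq_zero_comm hs.isStarProjection hr h, hr.mul_self]
    | some i => by
      have : e i * r = 0 := by rw [← hs.mul_eq i, mul_assoc, h, mul_zero]
      simp [mul_add, hs.mul_eq, this]
  mul_eq_zero x hx := by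
    rw [add_mul, hs.mul_eq_zero x fun i => hx (some i), show r * x = 0 from hx none, add_zero]

/-- A supremum over a product splits along the two values of the second factor. -/
theorem isSup_add_of_bool {e : ι × Bool → A} {s a b : A} (hs : IsSup e s)
    (ha : IsSup (fun i => e (i, false)) a) (hb : IsSup (fun i => e (i, true)) b)
    (hab : a * b = 0) : s = a + b := by
  have hP := isStarProjection_add ha.isStarProjection hb.isStarProjection hab
  have hba := mul_eq_zero_comm ha.isStarProjection hb.isStarProjection hab
  have h1 : s * (a + b) = s := hs.le fun ⟨i, c⟩ => by
    have h1 := ha.mul_eq i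
    have h2 := hb.mul_eq i
    cases c
    · have : e (i, false) * b = 0 := by rw [← h1, mul_assoc, hab, mul_zero]
      rw [mul_add, h1, this, add_zero]
    · have : e (i, true) * a = 0 := by rw [← h2, mul_assoc, hba, mul_zero]
      rw [mul_add, h2, this, zero_add]
  have h2 : a * s = a := ha.le fun i => hs.mul_eq _
  have h3 : b * s = b := hb.le fun i => hs.mul_eq _
  have h4 : (a + b) * s = a + b := by rw [add_mul, h2, h3]
  rw [← h1, mul_comm_of_mul_eq_left hP hs.isStarProjection h4]

/-- The complement of the projection that generates the right annihilator of the family. -/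
theorem exists_isSup [IsAWStarAlgebra A] (e : ι → A) : ∃ s, IsSup e s := by
  obtain ⟨p, hp, h⟩ := IsAWStarAlgebra.exists_annihilator_eq (Set.range e)
  have key : ∀ x, (∀ i, e i * x = 0) ↔ ∃ a, x = p * a := fun x => by
    have := Set.ext_iff.mp h x
    simpa using this
  refine ⟨1 - p, hp.one_sub, fun i => ?_, fun x hx => ?_⟩
  · rw [mul_sub, (key p).mpr ⟨1, by simp⟩ i]; simp
  · obtain ⟨a, rfl⟩ := (key x).mp hx
    rw [← mul_assoc, hp.one_sub_mul_self, zero_mul]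

theorem exists_annihilator [IsAWStarAlgebra A] (S : Set A) :
    ∃ p, IsStarProjection p ∧ (∀ x ∈ S, x * p = 0) ∧ ∀ y, (∀ x ∈ S, x * y = 0) → p * y = y := by
  obtain ⟨p, hp, h⟩ := IsAWStarAlgebra.exists_annihilator_eq S
  refine ⟨p, hp, (Set.ext_iff.mp h p).mpr ⟨1, by simp⟩, fun y hy => ?_⟩
  obtain ⟨a, rfl⟩ := (Set.ext_iff.mp h y).mp hy
  rw [← mul_assoc, hp.mul_self]

/-- Orthogonal additivity of subequivalence. -/
theorem sub_of_isSup_of_mul_eq_zero [IsAWStarAlgebra A] {e f : ι → A} {s t : A}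
    (he : ∀ i, IsStarProjection (e i)) (hf : ∀ i, IsStarProjection (f i))
    (heo : Pairwise fun i j => e i * e j = 0) (hfo : Pairwise fun i j => f i * f j = 0)
    (hs : IsSup e s) (ht : IsSup f t) (hst : s * t = 0) (h : ∀ i, Sub (e i) (f i)) :
    Sub s t := by
  choose v hv hfv using h
  have hve : ∀ i, v i * e i = v i := fun i => mul_eq_self_of_star_mul_self (he i) (hv i)
  have hev : ∀ i, e i * star (v i) = star (v i) := fun i => by
    simpa [(he i).star_eq] using star_mul_eq (hve i)
  have hvf : ∀ i, star (v i) * f i = star (v i) := fun i => by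
    simpa [(hf i).star_eq] using star_mul_eq (hfv i)
  have hef : ∀ i j, e i * f j = 0 := fun i j => by
    rw [← hs.mul_eq i, ← ht.mul_left hf j, mul_assoc, mul_mul_of_mul_eq hst]; simp
  have hfe : ∀ i j, f i * e j = 0 := fun i j => mul_eq_zero_comm (he _) (hf _) (hef _ _)
  have hev0 : ∀ i j, e i * v j = 0 := fun i j => by
    rw [← hfv j, mul_mul_of_mul_eq (hef i j), zero_mul]
  have hve0 : ∀ i j, star (v i) * e j = 0 := fun i j => by
    rw [← hvf i, mul_assoc, hfe, mul_zero]
  have hvv0 : ∀ i j, v i * v j = 0 := fun i j => by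
    rw [← hve i, mul_assoc, hev0, mul_zero]
  have hvv0' : ∀ i j, star (v i) * star (v j) = 0 := fun i j => by
    simpa using star_mul_eq (hvv0 j i)
  have hvve : ∀ i, v i * (star (v i) * v i) = v i := fun i => by rw [hv, hve]
  have hvvs : ∀ i, star (v i) * (v i * star (v i)) = star (v i) := fun i => by
    rw [mul_mul_of_mul_eq (hv i), hev]
  -- `g i` projects onto the graph of `v i`. The `v i` cannot be summed as a limit, so their graphs
  -- are joined in the supremum `G`, and the sum is read off as the corner `w = 2 t G s`.
  set g : ι → A := fun i => (2⁻¹ : ℂ) • (e i + v i * star (v i) + v i + star (v i)) with hg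
  have hgs : ∀ i, star (g i) = g i := fun i => by
    simp only [hg, star_smul, star_add, star_mul, star_star, (he i).star_eq]
    congr 1
    · simp
    · abel
  obtain ⟨G, hG⟩ := exists_isSup g
  have hGg : ∀ i, G * g i = g i := fun i => by
    simpa [hgs i, hG.isStarProjection.star_eq] using star_mul_eq (hG.mul_eq i)
  -- Each `g j` kills the projection onto the graph of `-v i`, hence so does `G`; thus `G` maps `e i
  -- + v i v i⋆` exactly to `g i`.
  have hkk : ∀ j i, g j * (e i + v i * star (v i) - v i - star (v i)) = 0 := fun j i => by
    rw [hg, smul_mul_assoc]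
    by_cases hij : j = i
    · subst hij
      simp only [add_mul, mul_sub, mul_add, mul_assoc, (he j).mul_self, hvvs, hev, hve0,
        hve, hvv0, hvv0', hv, hev0, mul_mul_of_mul_eq (hev0 j j),
        mul_mul_of_mul_eq (hvv0 j j), mul_zero, zero_mul]
      rw [smul_eq_zero]; right; abel
    · have hee := heo hij
      have h1 : v j * e i = 0 := by rw [← hve j, mul_assoc, hee, mul_zero]
      have h2 : v j * star (v i) = 0 := by rw [← hev i, mul_mul_of_mul_eq h1, zero_mul]
      have h3 : star (v j) * v i = 0 := by
        rw [← hfv i, ← hvf j, mul_assoc, mul_mul_of_mul_eq (hfo hij)]; simp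
      have h4 : e j * star (v i) = 0 := by rw [← hev i, mul_mul_of_mul_eq hee, zero_mul]
      simp only [add_mul, mul_sub, mul_add, mul_assoc, hee, h1, h2, h3, h4, hve0, hvv0, hvv0',
        hev0, mul_mul_of_mul_eq (hev0 j i), mul_mul_of_mul_eq (hvv0 j i), mul_mul_of_mul_eq h3,
        mul_zero, zero_mul]
      simp
  have hGk : ∀ i, G * (e i + v i * star (v i)) = e i + v i * star (v i) -
      (2⁻¹ : ℂ) • (e i + v i * star (v i) - v i - star (v i)) := fun i => by
    have h1 := hG.mul_eq_zero _ (fun j => hkk j i)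
    have h2 : e i + v i * star (v i) =
        g i + (2⁻¹ : ℂ) • (e i + v i * star (v i) - v i - star (v i)) := by
      rw [hg]; module
    have h3 : G * (e i + v i * star (v i)) = g i := by
      conv_lhs => rw [h2, mul_add, hGg, mul_smul_comm, h1]
      simp
    rw [h3]
    exact eq_sub_of_add_eq h2.symm
  have hGe : ∀ i, (2 : ℂ) • (G * e i) = e i + v i := fun i => by
    have h1 := congrArg (· * e i) (hGk i)
    simp only [mul_assoc, add_mul, sub_mul, smul_mul_assoc, (he i).mul_self, hve0, hve, mul_zero,
      add_zero, sub_zero] at h1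
    rw [h1]; module
  have hGf : ∀ i, (2 : ℂ) • (star (v i) * G) = star (v i) + e i := fun i => by
    have h1 := congrArg (star (v i) * ·) (congrArg star (hGk i))
    simp only [star_mul, star_add, star_sub, star_smul, star_star, (he i).star_eq, mul_add,
      mul_sub, mul_smul_comm, hve0, hvvs, hvv0', hv, hG.isStarProjection.star_eq,
      zero_add, mul_assoc] at h1
    simp only [mul_mul_of_mul_eq (hv i), mul_mul_of_mul_eq (hev i),
      mul_mul_of_mul_eq (hve0 i i), zero_mul, zero_add] at h1
    rw [h1]
    simp only [star_inv₀, star_ofNat]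
    module
  have hte : ∀ i, t * e i = 0 := fun i => by
    rw [← hs.mul_left he, mul_mul_of_mul_eq
      (mul_eq_zero_comm hs.isStarProjection ht.isStarProjection hst), zero_mul]
  have htv : ∀ i, t * v i = v i := fun i => by
    rw [← hfv i, mul_mul_of_mul_eq (ht.mul_left hf i)]
  have hvs : ∀ i, star (v i) * s = 0 := fun i => by
    have : s * v i = 0 := by
      rw [← htv i, mul_mul_of_mul_eq hst, zero_mul]
    simpa [hs.isStarProjection.star_eq] using star_mul_eq this
  set w : A := (2 : ℂ) • (t * (G * s)) with hw
  have hwe : ∀ i, w * e i = v i := fun i => by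
    have : w * e i = t * ((2 : ℂ) • (G * e i)) := by
      rw [hw, smul_mul_assoc, mul_assoc, mul_assoc, hs.mul_left he, mul_smul_comm]
    rw [this, hGe, mul_add, hte, htv, zero_add]
  have hvt : ∀ i, star (v i) * t = star (v i) := fun i => by
    simpa [ht.isStarProjection.star_eq] using star_mul_eq (htv i)
  have hvw : ∀ i, star (v i) * w = e i := fun i => by
    have : star (v i) * w = ((2 : ℂ) • (star (v i) * G)) * s := by
      rw [hw, mul_smul_comm, mul_mul_of_mul_eq (hvt i), smul_mul_assoc, mul_assoc]
    rw [this, hGf, add_mul, hvs, hs.mul_eq, zero_add]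
  have hww : ∀ i, e i * (star w * w) = e i * 1 := fun i => by
    have h1 : e i * star w = star (v i) := by
      simpa [(he i).star_eq] using star_mul_eq (hwe i)
    rw [mul_mul_of_mul_eq h1, hvw, mul_one]
  have hsw : s * star w = star w := by
    rw [hw, star_smul, star_mul, star_mul, hs.isStarProjection.star_eq, mul_smul_comm]
    simp only [← mul_assoc, hs.isStarProjection.mul_self]
  refine ⟨w, ?_, ?_⟩
  · have := hs.mul_eq_of_forall hww
    rwa [← mul_assoc, hsw, mul_one] at this
  · rw [hw, mul_smul_comm, mul_mul_of_mul_eq ht.isStarProjection.mul_self]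

end Algebraic

/-! ### Partial isometries and comparability. -/

section Comparison

variable {A : Type*} [CStarAlgebra A]

/-- Zorn's lemma for families of elements that are pairwise related. -/
theorem exists_maximal_pairwise {α : Type*} (P : α → Prop) (R : α → α → Prop) (W₀ : Set α)
    (h₀ : ∀ x ∈ W₀, P x) (h₀' : W₀.Pairwise R) :
    ∃ W : Set α, W₀ ⊆ W ∧ (∀ x ∈ W, P x) ∧ W.Pairwise R ∧
      ∀ x, P x → (∀ w ∈ W, R w x ∧ R x w) → x ∈ W := by
  obtain ⟨W, hW, hmax⟩ := zorn_subset_nonempty {W : Set α | (∀ x ∈ W, P x) ∧ W.Pairwise R}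
    (fun c hc hchain _ => ⟨⋃₀ c, ⟨fun x ⟨s, hs, hx⟩ => (hc hs).1 x hx,
      (Set.pairwise_sUnion hchain.directedOn).mpr fun s hs => (hc hs).2⟩,
      fun s hs => Set.subset_sUnion_of_mem hs⟩) W₀ ⟨h₀, h₀'⟩
  refine ⟨W, hW, hmax.prop.1, hmax.prop.2, fun x hx hxR => ?_⟩
  have : insert x W ⊆ W := hmax.le_of_ge ⟨fun y hy => hy.elim (fun h => h ▸ hx) (hmax.prop.1 y),
    hmax.prop.2.insert fun w hw _ => ⟨(hxR w hw).2, (hxR w hw).1⟩⟩ (Set.subset_insert x W)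
  exact this (Set.mem_insert x W)

/-- A nonzero element of `f A e` has a nonzero partial isometry of the form `x y` in `f A e`. -/
theorem exists_partialIsometry_of_ne_zero [IsAWStarAlgebra A] {x e f : A}
    (hf : f * x = x) (hxe : x * e = x) (hx : x ≠ 0) :
    ∃ w : A, IsStarProjection (star w * w) ∧ w ≠ 0 ∧ w * e = w ∧ f * w = w := by
  set a := star x * x with ha_def
  have ha : IsSelfAdjoint a := IsSelfAdjoint.star_mul_self x
  have ha0 : a ≠ 0 := fun h => hx (CStarRing.star_mul_self_eq_zero_iff _ |>.mp h)
  -- The factor `2` makes `(a - r)₊` take the value `r > 0` on the spectrum, so `c ≠ 0`.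
  obtain ⟨r, hr, hrs⟩ : ∃ r : ℝ, 0 < r ∧ 2 * r ∈ spectrum ℝ a := by
    by_contra! hcon
    apply ha0
    rw [← cfc_id ℝ a]
    rw [cfc_congr (g := fun _ => 0), cfc_const_zero]
    intro t ht
    rcases (spectrum_star_mul_self_nonneg t ht).lt_or_eq with h | h
    · refine absurd ht ?_
      have := hcon (t / 2) (by linarith)
      rwa [mul_div_cancel₀ t two_ne_zero] at this
    · exact h.symm
  have hm0 : ∀ t : ℝ, max t r ≠ 0 := fun t => (lt_max_of_lt_right hr).ne'
  have hy1 : Continuous fun t : ℝ => (√(max t r))⁻¹ :=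
    Continuous.inv₀ (by fun_prop) fun t => (Real.sqrt_pos.mpr (lt_max_of_lt_right hr)).ne'
  have hk1 : Continuous fun t : ℝ => max (t - r) 0 / max t r :=
    Continuous.div (by fun_prop) (by fun_prop) hm0
  -- The annihilator `p` of `b = (r - a)₊` acts as a spectral projection of `a` for `[r, ∞)`, and `y
  -- = max(a, r)^(-1/2)` normalizes `x` there: `x y p` is a partial isometry. It is nonzero because
  -- `p` dominates `c = (a - r)₊`.
  set b := cfc (fun t : ℝ => max (r - t) 0) a with hb
  set c := cfc (fun t : ℝ => max (t - r) 0) a with hc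
  set y := cfc (fun t : ℝ => (√(max t r))⁻¹) a with hy
  set k := cfc (fun t : ℝ => max (t - r) 0 / max t r) a with hk
  have hbc : b * c = 0 := by
    rw [hb, hc, ← cfc_mul _ _ a (by fun_prop) (by fun_prop), ← cfc_const_zero ℝ a]
    congr 1; ext t
    rcases le_total t r with h | h
    · rw [max_eq_right (sub_nonpos.mpr h), mul_zero]
    · rw [max_eq_right (sub_nonpos.mpr h), zero_mul]
  have hc0 : c ≠ 0 := by
    intro h
    rw [hc, ← cfc_const_zero ℝ a, cfc_eq_cfc_iff_eqOn (R := ℝ) (a := a) ha (by fun_prop) (by fun_prop)] at h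
    have := h hrs
    simp only at this
    rw [max_eq_left (by linarith)] at this
    linarith
  have hkc : c = k * a := by
    conv_rhs => rw [← cfc_id ℝ a]
    rw [hc, hk, cfc_id ℝ a]
    conv_rhs => enter [2]; rw [← cfc_id ℝ a]
    rw [← cfc_mul _ _ a hk1.continuousOn (by fun_prop)]
    congr 1; ext t
    rcases le_total t r with h | h
    · simp [max_eq_right (sub_nonpos.mpr h)]
    · have : t ≠ 0 := by linarith
      simp only [max_eq_left h, id]
      field_simp
  have hbr : b = algebraMap ℝ A r - a + c := by
    conv_rhs => enter [1, 2]; rw [← cfc_id ℝ a]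
    rw [hb, hc, ← cfc_const r a, ← cfc_sub _ _ a (by fun_prop) (by fun_prop),
      ← cfc_add a _ _ (by fun_prop) (by fun_prop)]
    congr 1; ext t
    rcases le_total t r with h | h
    · simp [h]
    · simp [h]
  have hyb : y * b = b * y := cfc_commute_cfc _ _ a
  have hys : star y = y := (cfc_predicate (R := ℝ) _ a : IsSelfAdjoint y).star_eq
  have hyay : y * a * y = 1 - y * y * b := by
    rw [eq_sub_iff_add_eq]
    conv_lhs => enter [1, 1, 2]; rw [← cfc_id ℝ a]
    rw [hb, hy, ← cfc_mul _ _ a hy1.continuousOn (by fun_prop),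
      ← cfc_mul (fun t => (√(max t r))⁻¹ * id t) _ a (hy1.mul continuous_id).continuousOn hy1.continuousOn,
      ← cfc_mul _ _ a hy1.continuousOn hy1.continuousOn,
      ← cfc_mul (fun t => (√(max t r))⁻¹ * (√(max t r))⁻¹) _ a (hy1.mul hy1).continuousOn (by fun_prop),
      ← cfc_add a _ _ (by fun_prop) (by fun_prop), ← cfc_const_one ℝ a]
    congr 1; ext t
    have h1 : (√(max t r))⁻¹ * (√(max t r))⁻¹ = (max t r)⁻¹ := by
      rw [← mul_inv, Real.mul_self_sqrt (le_max_of_le_right hr.le)]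
    have h2 : max t r = t + max (r - t) 0 := by
      rcases le_total t r with h | h
      · simp [h]
      · simp [h]
    calc _ = ((√(max t r))⁻¹ * (√(max t r))⁻¹) * (t + max (r - t) 0) := by simp only [id]; ring
      _ = 1 := by rw [h1, ← h2, inv_mul_cancel₀ (hm0 t)]
  obtain ⟨p, hp, hbp, hpb⟩ := exists_annihilator {b}
  simp only [Set.mem_singleton_iff, forall_eq] at hbp hpb
  have hpc := hpb c hbc
  have hp0 : p ≠ 0 := fun h => hc0 (by rw [← hpc, h, zero_mul])
  have hww : star (x * (y * p)) * (x * (y * p)) = p := by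
    calc star (x * (y * p)) * (x * (y * p)) = p * (y * a * y) * p := by
          simp only [star_mul, hp.star_eq, hys, ha_def, mul_assoc]
      _ = p * p - p * (y * (y * b)) * p := by rw [hyay]; simp [mul_sub, sub_mul, mul_assoc]
      _ = p := by
        simp [mul_assoc, hbp, hp.mul_self]
  -- On `1 - e` the element `a` vanishes and `b` is the scalar `r`, so `p b = 0` forces `p (1 - e) =
  -- 0`.
  have hpe : p * e = p := by
    have h1 : a * (1 - e) = 0 := by rw [ha_def, mul_assoc, mul_sub, hxe]; simp
    have h2 : b * (1 - e) = algebraMap ℝ A r * (1 - e) := by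
      rw [hbr, add_mul, sub_mul, hkc, mul_assoc k, h1]; simp
    have h3 : p * b = 0 := by
      have hbs : star b = b := (cfc_predicate (R := ℝ) _ a : IsSelfAdjoint b).star_eq
      simpa [hp.star_eq, hbs] using star_mul_eq hbp
    have h4 : r • (p * (1 - e)) = 0 := by
      have := congrArg (p * ·) h2
      simp only [← mul_assoc, h3, zero_mul] at this
      rw [← mul_smul_comm, Algebra.smul_def, ← mul_assoc, ← this]
    have h5 := (smul_eq_zero.mp h4).resolve_left hr.ne'
    rw [mul_sub, mul_one, sub_eq_zero] at h5
    exact h5.symm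
  refine ⟨x * (y * p), by rwa [hww], fun h => hp0 ?_, by simp only [mul_assoc, hpe], by
    rw [← mul_assoc, hf]⟩
  rw [← hww, h, mul_zero]

/-- Comparability of orthogonal projections. -/
theorem exists_central_sub_sub [IsAWStarAlgebra A] {e f : A} (he : IsStarProjection e)
    (hf : IsStarProjection f) (hef : e * f = 0) :
    ∃ z : A, IsStarProjection z ∧ (∀ a : A, z * a = a * z) ∧
      Sub (z * e) (z * f) ∧ Sub ((1 - z) * f) ((1 - z) * e) := by
  obtain ⟨W, -, hW, hWR, hmax⟩ := exists_maximal_pairwise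
    (fun v : A => IsStarProjection (star v * v) ∧ v ≠ 0 ∧ v * e = v ∧ f * v = v)
    (fun v w => star v * w = 0 ∧ v * star w = 0) ∅ (by simp) (by simp)
  have hfe := mul_eq_zero_comm he hf hef
  obtain ⟨s, hs⟩ := exists_isSup fun v : W => star v.1 * v.1
  obtain ⟨t, ht⟩ := exists_isSup fun v : W => v.1 * star v.1
  have hv1 : ∀ v : W, IsStarProjection (star v.1 * v.1) := fun v => (hW v v.2).1
  have hv2 : ∀ v : W, IsStarProjection (v.1 * star v.1) := fun v =>
    isStarProjection_mul_star (hv1 v) rfl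
  have hvv : ∀ v : W, v.1 * (star v.1 * v.1) = v.1 := fun v =>
    mul_eq_self_of_star_mul_self (hv1 v) rfl
  have hvvs : ∀ v : W, star v.1 * (v.1 * star v.1) = star v.1 := fun v => by
    simpa [mul_assoc] using congrArg star (hvv v)
  have hse : s * e = s := hs.le fun v => by rw [mul_assoc, (hW v v.2).2.2.1]
  have htf : t * f = t := ht.le fun v => by
    have := star_mul_eq (hW v v.2).2.2.2
    rw [hf.star_eq] at this
    rw [mul_assoc, this]
  have hes := mul_comm_of_mul_eq_left hs.isStarProjection he hse
  have hft := mul_comm_of_mul_eq_left ht.isStarProjection hf htf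
  have hst : s * t = 0 := by rw [← hse, ← hft, mul_assoc, mul_mul_of_mul_eq hef]; simp
  have ho1 : Pairwise fun v w : W => star v.1 * v.1 * (star w.1 * w.1) = 0 := fun v w h => by
    have := (hWR v.2 w.2 fun h' => h (Subtype.ext h')).2
    simp only [mul_assoc, mul_mul_of_mul_eq this, zero_mul, mul_zero]
  have ho2 : Pairwise fun v w : W => v.1 * star v.1 * (w.1 * star w.1) = 0 := fun v w h => by
    have := (hWR v.2 w.2 fun h' => h (Subtype.ext h')).1
    simp only [mul_assoc, mul_mul_of_mul_eq this, zero_mul, mul_zero]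
  have hS1 : Sub s t := sub_of_isSup_of_mul_eq_zero hv1 hv2 ho1 ho2 hs ht hst fun v =>
    ⟨v, rfl, by rw [mul_assoc, hvv]⟩
  have hS2 : Sub t s := sub_of_isSup_of_mul_eq_zero hv2 hv1 ho2 ho1 ht hs
    (mul_eq_zero_comm hs.isStarProjection ht.isStarProjection hst) fun v =>
    ⟨star v.1, by simp, by rw [mul_assoc, hvvs]⟩
  -- A nonzero corner would yield one more partial isometry for the maximal family.
  have h0 : ∀ a : A, (e - s) * a * (f - t) = 0 := fun a => by
    by_contra hne
    set x := (f - t) * star a * (e - s) with hx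
    have hx0 : x ≠ 0 := fun h => hne (by
      have := congrArg star h
      simpa [hx, he.star_eq, hf.star_eq, hs.isStarProjection.star_eq, ht.isStarProjection.star_eq,
        mul_assoc] using this)
    have hP1 := isStarProjection_sub hs.isStarProjection he hse
    have hP2 := isStarProjection_sub ht.isStarProjection hf htf
    obtain ⟨w, hw1, hw0, hw2, hw3⟩ := exists_partialIsometry_of_ne_zero (x := x) (e := e - s)
      (f := f - t)
      (by rw [hx]; simp only [← mul_assoc, hP2.mul_self])
      (by rw [hx]; simp only [mul_assoc, hP1.mul_self]) hx0
    have hwe : w * e = w := by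
      rw [← hw2, mul_assoc, sub_mul, hse, he.mul_self]
    have hfw : f * w = w := by
      rw [← hw3, ← mul_assoc, mul_sub, hft, hf.mul_self]
    have hws : w * s = 0 := by
      rw [← hw2, mul_assoc, sub_mul, hes, hs.isStarProjection.mul_self, sub_self, mul_zero]
    have htw : t * w = 0 := by
      rw [← hw3, ← mul_assoc, mul_sub, htf, ht.isStarProjection.mul_self, sub_self, zero_mul]
    have hmem : w ∈ W := by
      refine hmax w ⟨hw1, hw0, hwe, hfw⟩ fun v hv => ?_
      have h1 : star v * w = 0 := by
        have h4 := ht.mul_eq ⟨v, hv⟩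
        have h5 := hvvs ⟨v, hv⟩
        simp only at h4 h5
        rw [← h5, ← h4]
        simp only [mul_assoc, htw, mul_zero]
      have h2 : v * star w = 0 := by
        have h3 : s * star w = 0 := by
          simpa [hs.isStarProjection.star_eq] using star_mul_eq hws
        have h4 := hs.mul_eq ⟨v, hv⟩
        have h5 := hvv ⟨v, hv⟩
        simp only at h4 h5
        rw [← h5, ← h4]
        simp only [mul_assoc, h3, mul_zero]
      exact ⟨⟨h1, h2⟩, ⟨by simpa using star_mul_eq h1, by simpa using star_mul_eq h2⟩⟩
    apply hw0
    have h4 := hs.mul_left hv1 ⟨w, hmem⟩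
    have h5 := hvv ⟨w, hmem⟩
    simp only at h4 h5
    rw [← h5, ← h4]
    simp only [← mul_assoc, hws, zero_mul]
  -- The right annihilator of a right ideal is two-sided, so its generating projection `z` is
  -- central. It kills `e - s` and fixes `f - t`.
  obtain ⟨z, hz, hz1, hz2⟩ := exists_annihilator (Set.range fun a : A => (e - s) * a)
  simp only [Set.mem_range, forall_exists_index, forall_apply_eq_imp_iff] at hz1 hz2
  have hzz : ∀ a, z * (a * z) = a * z := fun a => hz2 _ fun b => by
    have := hz1 (b * a)
    simpa only [mul_assoc] using this
  have hzc : ∀ a, z * a = a * z := fun a => by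
    have := congrArg star (hzz (star a))
    simp only [star_mul, star_star, hz.star_eq] at this
    rw [← this, mul_assoc, hzz]
  have hzes : z * e = z * s := by
    have := hz1 1
    rw [mul_one, ← hzc, mul_sub, sub_eq_zero] at this
    exact this
  have hzft : (1 - z) * f = (1 - z) * t := by
    have := hz2 _ h0
    rw [sub_mul, sub_mul, one_mul, one_mul, sub_eq_sub_iff_sub_eq_sub, ← mul_sub, this]
  have hz' := hz.one_sub
  have hzc' : ∀ a, (1 - z) * a = a * (1 - z) := fun a => by rw [sub_mul, mul_sub, hzc]; simp
  refine ⟨z, hz, hzc, ?_, ?_⟩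
  · rw [hzes]
    exact (hS1.mono_right ht.isStarProjection hf htf).central_mul hz hzc
  · rw [hzft]
    exact (hS2.mono_right hs.isStarProjection he hse).central_mul hz' hzc'

end Comparison

universe u

/-! ### Infinite projections and halving. -/

section Halving

variable {A : Type*} [CStarAlgebra A]

theorem central_mul_mul {z : A} (hz : IsStarProjection z) (hzc : ∀ a : A, z * a = a * z)
    (x y : A) : z * x * (z * y) = z * (x * y) := by
  rw [hzc x, mul_assoc, mul_mul_of_mul_eq hz.mul_self, ← mul_assoc, ← hzc, mul_assoc]

theorem central_mul_central {z z' : A} (hzc : ∀ a : A, z * a = a * z)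
    (hzc' : ∀ a : A, z' * a = a * z') (a : A) : z * z' * a = a * (z * z') := by
  rw [mul_assoc, hzc', ← mul_assoc, hzc, mul_assoc]

/-- The two halves of `f` receive `f` and `e` separately, so `e` and `f` need not be orthogonal. -/
theorem Sub.add_of_halved_right {e f : A} (h : Halved f)
    (hs : Sub e f) : Sub (f + e) f := by
  obtain ⟨s, t, hs1, ht1, hst, hfs, hft⟩ := h
  obtain ⟨v, hv, hfv⟩ := hs
  have hts : star t * s = 0 := by simpa using star_mul_eq hst
  refine ⟨s + t * v, ?_, by rw [mul_add, hfs, ← mul_assoc, hft]⟩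
  simp only [star_add, star_mul, add_mul, mul_add, mul_assoc, hs1, hts, mul_mul_of_mul_eq ht1,
    mul_mul_of_mul_eq hst, hfv, hv, zero_mul, mul_zero]
  simp

/-- Nothing moves in `f - v v⋆`; the copy `v v⋆` of `e` has two halves, which receive that copy
(through `s`) and `e` itself (through `t`). -/
theorem Sub.add_of_halved_left {e f : A} (he : IsStarProjection e) (hf : IsStarProjection f)
    (h : Halved e) (hs : Sub e f) : Sub (e + f) f := by
  obtain ⟨s, t, hs1, ht1, hst, hes, het⟩ := h
  obtain ⟨v, hv, hfv⟩ := hs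
  have hts : star t * s = 0 := by simpa using star_mul_eq hst
  have hve := mul_eq_self_of_star_mul_self he hv
  have hev : e * star v = star v := by simpa [he.star_eq] using star_mul_eq hve
  have hvf : star v * f = star v := by simpa [hf.star_eq] using star_mul_eq hfv
  refine ⟨(f - v * star v) + v * s * star v + v * t, ?_, ?_⟩
  · simp only [star_add, star_sub, star_mul, star_star, hf.star_eq, add_mul, mul_add, sub_mul,
      mul_sub, mul_assoc, hf.mul_self, hvf, mul_mul_of_mul_eq hfv, mul_mul_of_mul_eq hv, hev,
      mul_mul_of_mul_eq hes, het, mul_mul_of_mul_eq hs1,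
      mul_mul_of_mul_eq hts, hst, ht1, mul_zero, zero_mul]
    abel
  · simp only [mul_add, mul_sub, hf.mul_self, ← mul_assoc, hfv]

theorem halved_of_sub_sub {a b c : A} (hb : IsStarProjection b) (hab : Sub a b) (hac : Sub a c)
    (hbc : b * c = 0) (hba : a * b = b) (hca : a * c = c) : Halved a := by
  obtain ⟨s, hs, hs'⟩ := hab
  obtain ⟨t, ht, ht'⟩ := hac
  refine ⟨s, t, hs, ht, ?_, ?_, ?_⟩
  · rw [← hs', ← ht', star_mul, hb.star_eq, mul_assoc, mul_mul_of_mul_eq hbc]; simp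
  · rw [← hs', mul_mul_of_mul_eq hba]
  · rw [← ht', mul_mul_of_mul_eq hca]

theorem Halved.of_sub {a q : A} (h : Halved a) (hqa : Sub q a) (haq : q * a = a) : Halved q := by
  obtain ⟨s, t, hs, ht, hst, has, hat⟩ := h
  obtain ⟨w, hw, hw'⟩ := hqa
  refine ⟨s * w, t * w, ?_, ?_, ?_, ?_, ?_⟩
  · rw [star_mul, mul_assoc, mul_mul_of_mul_eq hs, hw', hw]
  · rw [star_mul, mul_assoc, mul_mul_of_mul_eq ht, hw', hw]
  · rw [star_mul, mul_assoc, mul_mul_of_mul_eq hst]; simp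
  · rw [← has]; simp only [← mul_assoc, haq]
  · rw [← hat]; simp only [← mul_assoc, haq]

theorem Halved.central_mul {f z : A} (h : Halved f) (hz : IsStarProjection z)
    (hzc : ∀ a : A, z * a = a * z) : Halved (z * f) := by
  obtain ⟨s, t, hs, ht, hst, hfs, hft⟩ := h
  have key : ∀ x y : A, star (z * x) * (z * y) = z * (star x * y) := fun x y => by
    rw [star_mul, hz.star_eq, mul_assoc, mul_mul_of_mul_eq hz.mul_self, ← mul_assoc, ← hzc,
      mul_assoc]
  exact ⟨z * s, z * t, by rw [key, hs], by rw [key, ht], by rw [key, hst, mul_zero],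
    by rw [central_mul_mul hz hzc, hfs],
    by rw [central_mul_mul hz hzc, hft]⟩

/-- A maximal orthogonal family of copies of `f₀` below `q`, containing the orbit of `f₀` under
an isometry `u` of `e`: the remainder is dominated by `f₀` on a central projection. -/
theorem exists_copies {A : Type u} [CStarAlgebra A] [IsAWStarAlgebra A] {q e f₀ x : A}
    (hq : IsStarProjection q) (he : IsStarProjection e)
    (hf₀ : IsStarProjection f₀) (heq : e * q = e) (hx : star x * x = e) (hex : e * x = x)
    (hfe : f₀ * e = f₀) (hfx : f₀ * x = 0) (h₀ : f₀ ≠ 0) :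
    ∃ (J : Type u) (_ : Infinite J) (g : J → A) (s z : A), (∀ j, IsStarProjection (g j)) ∧
      (∀ j, Sub (g j) f₀) ∧ (∀ j, Sub f₀ (g j)) ∧ (Pairwise fun i j => g i * g j = 0) ∧
      (∀ j, g j * q = g j) ∧ IsSup g s ∧ IsStarProjection z ∧ (∀ a, z * a = a * z) ∧
      z * f₀ ≠ 0 ∧ Sub (z * (q - s)) (z * f₀) := by
  have hqe := mul_comm_of_mul_eq_left he hq heq
  have hef := mul_comm_of_mul_eq_left hf₀ he hfe
  have hec : ∀ n : ℕ, e * (x ^ n * f₀) = x ^ n * f₀ := fun n => by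
    cases n with
    | zero => simpa using hef
    | succ n => rw [pow_succ', mul_assoc, ← mul_assoc e, hex]
  have hxc : ∀ m n : ℕ, star (x ^ (m + 1) * f₀) * (x ^ (n + 1) * f₀) =
      star (x ^ m * f₀) * (x ^ n * f₀) := fun m n => by
    rw [pow_succ' x m, mul_assoc x, star_mul x, pow_succ' x n, mul_assoc x, mul_assoc,
      mul_mul_of_mul_eq hx, hec]
  have hcc : ∀ n : ℕ, star (x ^ n * f₀) * (x ^ n * f₀) = f₀ := fun n => by
    induction n with
    | zero => simp [hf₀.star_eq, hf₀.mul_self]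
    | succ n ih => rw [hxc, ih]
  have hc0 : ∀ n : ℕ, star (x ^ 0 * f₀) * (x ^ (n + 1) * f₀) = 0 := fun n => by
    rw [pow_zero, one_mul, hf₀.star_eq, pow_succ', mul_assoc, mul_mul_of_mul_eq hfx, zero_mul]
  have hlt : ∀ k m : ℕ, star (x ^ m * f₀) * (x ^ (m + k + 1) * f₀) = 0 := fun k m => by
    induction m with
    | zero => rw [zero_add]; exact hc0 k
    | succ m ih => rw [show m + 1 + k + 1 = (m + k + 1) + 1 by ring, hxc, ih]
  have hne : ∀ m n : ℕ, m ≠ n → star (x ^ m * f₀) * (x ^ n * f₀) = 0 := fun m n h => by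
    rcases h.lt_or_gt with h | h
    · obtain ⟨k, rfl⟩ := Nat.exists_eq_add_of_lt h
      exact hlt k m
    · obtain ⟨k, rfl⟩ := Nat.exists_eq_add_of_lt h
      simpa using star_mul_eq (hlt k n)
  -- The range of the isometry `x` of `e` is orthogonal to `f₀`, so `f₀` is a wandering projection
  -- and its translates are orthogonal. They make the index set infinite.
  set p : ℕ → A := fun n => x ^ n * f₀ * star (x ^ n * f₀) with hp
  have hpp : ∀ n, IsStarProjection (p n) := fun n => isStarProjection_mul_star hf₀ (hcc n)
  have hpq : ∀ n, p n * q = p n := fun n => by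
    have h1 : q * (x ^ n * f₀) = x ^ n * f₀ := by rw [← hec n, mul_mul_of_mul_eq hqe]
    have h2 := star_mul_eq h1
    rw [hq.star_eq] at h2
    simp only [hp]
    rw [mul_assoc, h2]
  have hpo : ∀ m n, m ≠ n → p m * p n = 0 := fun m n h => by
    rw [hp]; simp only
    rw [mul_assoc, mul_mul_of_mul_eq (hne m n h)]; simp
  have hp0 : ∀ n, p n ≠ 0 := fun n h => h₀ (by
    have : star (x ^ n * f₀) * p n * (x ^ n * f₀) = f₀ := by
      rw [hp]; simp only
      rw [mul_mul_of_mul_eq (hcc n), mul_assoc, hcc, hf₀.mul_self]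
    rw [← this, h]; simp)
  have hpinj : Function.Injective p := fun m n h => by
    by_contra hmn
    have := hpo m n hmn
    rw [← h, (hpp m).mul_self] at this
    exact hp0 m this
  have hps : ∀ n, Sub (p n) f₀ := fun n => by
    refine ⟨star (x ^ n * f₀), by rw [star_star], ?_⟩
    rw [star_mul, hf₀.star_eq, mul_mul_of_mul_eq hf₀.mul_self]
  have hsp : ∀ n, Sub f₀ (p n) := fun n => by
    refine ⟨x ^ n * f₀, hcc n, ?_⟩
    simp only [hp]
    rw [mul_assoc, hcc, mul_assoc, hf₀.mul_self]
  obtain ⟨W, hW₀, hW, hWR, hmax⟩ := exists_maximal_pairwise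
    (fun g : A => IsStarProjection g ∧ g * q = g ∧ Sub g f₀ ∧ Sub f₀ g) (fun g h => g * h = 0)
    (Set.range p) (by rintro _ ⟨n, rfl⟩; exact ⟨hpp n, hpq n, hps n, hsp n⟩) (by
      rintro _ ⟨m, rfl⟩ _ ⟨n, rfl⟩ h
      exact hpo m n fun h' => h (h' ▸ rfl))
  have hinf : Infinite W := ((Set.infinite_range_of_injective hpinj).mono hW₀).to_subtype
  -- The translate `n = 0` is `f₀` itself; hence the remainder `q - s` is orthogonal to `f₀`, as
  -- comparability requires.
  have hf₀W : f₀ ∈ W := hW₀ ⟨0, by simp [hp, hf₀.star_eq, hf₀.mul_self]⟩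
  obtain ⟨s, hs⟩ := exists_isSup fun g : W => g.1
  have hsq : s * q = s := hs.le fun g => (hW g g.2).2.1
  have hqs := mul_comm_of_mul_eq_left hs.isStarProjection hq hsq
  have hr := isStarProjection_sub hs.isStarProjection hq hsq
  have hrf : (q - s) * f₀ = 0 := by
    have h1 : s * f₀ = f₀ := hs.mul_left (fun g => (hW g g.2).1) ⟨f₀, hf₀W⟩
    have h2 : q * f₀ = f₀ := by rw [← hef, mul_mul_of_mul_eq hqe]
    rw [sub_mul, h1, h2, sub_self]
  obtain ⟨z, hz, hzc, hz1, hz2⟩ := exists_central_sub_sub hr hf₀ hrf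
  refine ⟨W, hinf, Subtype.val, s, z, fun g => (hW g g.2).1, fun g => (hW g g.2).2.2.1,
    fun g => (hW g g.2).2.2.2, fun g h hgh => hWR g.2 h.2 fun h' => hgh (Subtype.ext h'),
    fun g => (hW g g.2).2.1, hs, hz, hzc, fun h0 => ?_, hz1⟩
  -- If `z f₀ = 0`, then `f₀` embeds into the remainder, giving a further copy against maximality.
  rw [sub_mul, one_mul, h0, sub_zero] at hz2
  obtain ⟨v, hv, hv'⟩ := hz2
  have hrv : (q - s) * v = v := by
    have h1 : (q - s) * ((1 - z) * (q - s)) = (1 - z) * (q - s) := by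
      have h2 : (1 - z) * (q - s) = (q - s) * (1 - z) := by
        rw [one_sub_mul, mul_one_sub, hzc]
      rw [h2, mul_mul_of_mul_eq hr.mul_self]
    rw [← hv', ← mul_assoc, h1]
  have hg := isStarProjection_mul_star hf₀ hv
  have hqv : q * v = v := by
    rw [← hrv, ← mul_assoc, mul_sub, hq.mul_self, hqs]
  have hsv : s * v = 0 := by
    rw [← hrv, ← mul_assoc, mul_sub, hsq, hs.isStarProjection.mul_self, sub_self, zero_mul]
  have hvf := mul_eq_self_of_star_mul_self hf₀ hv
  have hgq : v * star v * q = v * star v := by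
    have := star_mul_eq hqv
    rw [hq.star_eq] at this
    rw [mul_assoc, this]
  have hmem : v * star v ∈ W := by
    refine hmax _ ⟨hg, hgq, ⟨star v, by simp, ?_⟩, ⟨v, hv, ?_⟩⟩ fun w hw => ?_
    · simpa [hf₀.star_eq] using star_mul_eq hvf
    · rw [mul_assoc, hv, hvf]
    · have h1 : w * (v * star v) = 0 := by
        have h2 : w * s = w := hs.mul_eq ⟨w, hw⟩
        rw [← h2]
        simp only [mul_assoc, mul_mul_of_mul_eq hsv, zero_mul, mul_zero]
      exact ⟨h1, mul_eq_zero_comm (hW w hw).1 hg h1⟩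
  have h1 : s * (v * star v) = v * star v := hs.mul_left (fun g => (hW g g.2).1) ⟨_, hmem⟩
  rw [mul_mul_of_mul_eq hsv, zero_mul] at h1
  have h2 : v = 0 := CStarRing.mul_star_self_eq_zero_iff _ |>.mp h1.symm
  exact h₀ (by rw [← hv, h2, mul_zero])

/-- Subfamilies of a family of pairwise equivalent orthogonal projections with disjoint index
sets of the same cardinality have equivalent suprema. -/
theorem sub_of_isSup_comp [IsAWStarAlgebra A] {J κ : Type*} {g : J → A} {α β : κ → J} {a b : A}
    (hg : ∀ j, IsStarProjection (g j)) (hgo : Pairwise fun i j => g i * g j = 0)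
    (hgs : ∀ i j, Sub (g i) (g j)) (hα : α.Injective) (hβ : β.Injective)
    (hαβ : ∀ i j, α i ≠ β j) (ha : IsSup (fun k => g (α k)) a) (hb : IsSup (fun k => g (β k)) b) :
    a * b = 0 ∧ Sub a b := by
  have h0 : a * b = 0 := ha.mul_eq_zero_of_forall hb (fun _ => hg _) (fun _ => hg _)
    fun i j => hgo (hαβ i j)
  exact ⟨h0, sub_of_isSup_of_mul_eq_zero (fun _ => hg _) (fun _ => hg _)
    (fun i j h => hgo (hα.ne h)) (fun i j h => hgo (hβ.ne h)) ha hb h0 fun _ => hgs _ _⟩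

theorem exists_equiv_prod_bool (J : Type u) [Infinite J] : Nonempty (J × Bool ≃ J) := by
  refine Cardinal.eq.mp ?_
  have h : Cardinal.aleph0 ≤ Cardinal.mk J := Cardinal.infinite_iff.mp ‹_›
  rw [Cardinal.mk_prod, Cardinal.lift_uzero]
  exact Cardinal.mul_eq_left h ((Cardinal.lift_le_aleph0.mpr (Cardinal.mk_le_aleph0)).trans h)
    (by simp)

/-- An infinite projection is halved on some central projection. -/
theorem exists_central_halved {A : Type u} [CStarAlgebra A] [IsAWStarAlgebra A] {q : A}
    (hq : IsStarProjection q) (hinf : ¬ IsFiniteProj q) :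
    ∃ z : A, IsStarProjection z ∧ (∀ a, z * a = a * z) ∧ z * q ≠ 0 ∧ Halved (z * q) := by
  simp only [IsFiniteProj, ProjEquiv, ProjLE, not_forall] at hinf
  obtain ⟨f, hf, ⟨v, hv1, hv2⟩, hfq, hne⟩ := hinf
  have hqf := mul_comm_of_mul_eq_left hf hq hfq.symm
  have hfv : f * star v = star v := by
    simpa [hf.star_eq] using star_mul_eq (mul_eq_self_of_star_mul_self hf hv2.symm)
  have hqv : q * star v = star v := by rw [← hfv, mul_mul_of_mul_eq hqf]
  obtain ⟨J, hJ, g, s, z, hg, hgf, hfg, hgo, hgq, hs, hz, hzc, hz0, hzs⟩ :=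
    exists_copies (q := q) (e := q) (f₀ := q - f) (x := star v) hq hq
      (isStarProjection_sub hf hq hfq.symm) hq.mul_self (by simp [hv1]) hqv
      (by rw [sub_mul, hq.mul_self, ← hfq]) (by rw [sub_mul, hqv, hfv, sub_self])
      (sub_ne_zero.mpr hne)
  refine ⟨z, hz, hzc, fun h => hz0 ?_, ?_⟩
  · have : (q - f) * q = q - f := by rw [sub_mul, hq.mul_self, ← hfq]
    rw [← this, hzc, mul_assoc, ← hzc, h, mul_zero]
  -- `a` and `b` are the two halves of the cut family, `a₁` and `a₂` the quarters inside `a`.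
  -- Additivity needs disjoint index sets, so `a` reaches its own quarters by way of `b`.
  obtain ⟨φ⟩ := exists_equiv_prod_bool J
  have hg' : ∀ j, IsStarProjection (z * g j) := fun j => isStarProjection_mul hz (hg j) (hzc _)
  have hgo' : Pairwise fun i j => z * g i * (z * g j) = 0 := fun i j h => by
    simp only [central_mul_mul hz hzc, hgo h, mul_zero]
  have hgs' : ∀ i j, Sub (z * g i) (z * g j) := fun i j =>
    ((hgf i).trans (hfg j)).central_mul hz hzc
  have hs' := hs.central_mul hz hzc
  have hsq : s * q = s := hs.le hgq
  have hqs := mul_comm_of_mul_eq_left hs.isStarProjection hq hsq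
  obtain ⟨a, ha⟩ := exists_isSup fun j => z * g (φ (j, false))
  obtain ⟨b, hb⟩ := exists_isSup fun j => z * g (φ (j, true))
  obtain ⟨a₁, ha₁⟩ := exists_isSup fun j => z * g (φ (φ (j, false), false))
  obtain ⟨a₂, ha₂⟩ := exists_isSup fun j => z * g (φ (φ (j, true), false))
  have hφ : ∀ c, Function.Injective fun j => φ (j, c) := fun c i j h => by simpa using h
  have hφφ : ∀ c d, Function.Injective fun j => φ (φ (j, c), d) := fun c d i j h => by
    simpa using h
  have hab := sub_of_isSup_comp (g := fun j => z * g j) hg' hgo' hgs' (hφ false) (hφ true)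
    (by simp) ha hb
  have hba := sub_of_isSup_comp (g := fun j => z * g j) hg' hgo' hgs' (hφ true) (hφ false)
    (by simp) hb ha
  have h12 := sub_of_isSup_comp (g := fun j => z * g j) hg' hgo' hgs' (hφφ false false)
    (hφφ true false) (by simp) ha₁ ha₂
  have hb1 := sub_of_isSup_comp (g := fun j => z * g j) hg' hgo' hgs' (hφ true)
    (hφφ false false) (by simp) hb ha₁
  have hb2 := sub_of_isSup_comp (g := fun j => z * g j) hg' hgo' hgs' (hφ true)
    (hφφ true false) (by simp) hb ha₂
  have h1a : a₁ * a = a₁ := ha₁.le fun j => ha.mul_eq _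
  have h2a : a₂ * a = a₂ := ha₂.le fun j => ha.mul_eq _
  have hha : Halved a := halved_of_sub_sub ha₁.isStarProjection (hab.2.trans hb1.2)
    (hab.2.trans hb2.2) h12.1
    (mul_comm_of_mul_eq_left ha₁.isStarProjection ha.isStarProjection h1a)
    (mul_comm_of_mul_eq_left ha₂.isStarProjection ha.isStarProjection h2a)
  have hsab : z * s = a + b := isSup_add_of_bool (hs'.comp_equiv φ) ha hb hab.1
  have hP := isStarProjection_add ha.isStarProjection hb.isStarProjection hab.1
  have hsum : Sub (a + b) a := Sub.add_of_halved_right hha hba.2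
  have ha_ab : a * (a + b) = a := by rw [mul_add, ha.isStarProjection.mul_self, hab.1, add_zero]
  have hhab : Halved (a + b) := hha.of_sub hsum
    (mul_comm_of_mul_eq_left ha.isStarProjection hP ha_ab)
  have hj : Nonempty J := inferInstance
  obtain ⟨j⟩ := hj
  -- The remainder is no larger than a single copy, so the halved projection `a + b` absorbs it.
  have hr : Sub (z * (q - s)) (a + b) := by
    rw [← hsab]
    refine hzs.trans (((hfg j).central_mul hz hzc).mono_right (hg' j) hs'.isStarProjection ?_)
    exact hs'.mul_eq j
  have hq' := Sub.add_of_halved_right hhab hr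
  rw [← hsab, ← mul_add, add_sub_cancel] at hq'
  rw [← hsab] at hhab
  refine hhab.of_sub hq' ?_
  rw [central_mul_mul hz hzc, hqs]

end Halving

/-! ### Schröder–Bernstein and general additivity. -/

section SchroederBernstein

variable {A : Type*} [CStarAlgebra A]

theorem conj_mul_conj {x q p p' : A} (hx : star x * x = q) (hp : p * q = p) :
    x * p * star x * (x * p' * star x) = x * (p * p') * star x := by
  calc x * p * star x * (x * p' * star x) = x * p * (star x * x) * p' * star x := by
        simp only [mul_assoc]
    _ = x * (p * p') * star x := by rw [hx, mul_assoc x, hp]; simp only [mul_assoc]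

theorem isStarProjection_conj {x q p : A} (hx : star x * x = q) (hp : IsStarProjection p)
    (hpq : p * q = p) : IsStarProjection (x * p * star x) := by
  refine isStarProjection_of ?_ (by simp [hp.star_eq, mul_assoc])
  rw [conj_mul_conj hx hpq, hp.mul_self]

theorem sub_conj {x q p : A} (hx : star x * x = q) (hq : IsStarProjection q)
    (hp : IsStarProjection p) (hpq : p * q = p) :
    Sub p (x * p * star x) ∧ Sub (x * p * star x) p := by
  have hqp := mul_comm_of_mul_eq_left hp hq hpq
  refine ⟨⟨x * p, ?_, ?_⟩, ⟨p * star x, ?_, ?_⟩⟩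
  · rw [star_mul, mul_assoc, mul_mul_of_mul_eq hx, hp.star_eq, hqp, hp.mul_self]
  · rw [mul_assoc, mul_mul_of_mul_eq hx, hqp, mul_assoc, hp.mul_self]
  · rw [star_mul, star_star, hp.star_eq, mul_assoc, mul_mul_of_mul_eq hp.mul_self, mul_assoc]
  · rw [mul_mul_of_mul_eq hp.mul_self]

/-- The Schröder–Bernstein theorem for projections. -/
theorem Sub.antisymm [IsAWStarAlgebra A] {e f : A} (he : IsStarProjection e)
    (hf : IsStarProjection f) (h : Sub e f) (h' : Sub f e) : ProjEquiv e f := by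
  obtain ⟨x, hx, hfx⟩ := h
  obtain ⟨y, hy, hey⟩ := h'
  have hxf : star x * f = star x := by simpa [hf.star_eq] using star_mul_eq hfx
  have hye : star y * e = star y := by simpa [he.star_eq] using star_mul_eq hey
  -- Knaster–Tarski: `F` is monotone on the projections below `e`, so the supremum `s` of all `g ≤ F
  -- g` is a fixed point. Then `x` carries `s` to `f - k s` and `y` carries `k s` to `e - s`.
  set k : A → A := fun g => f - x * g * star x with hk
  set F : A → A := fun g => e - y * k g * star y with hF
  have hxgf : ∀ g, x * g * star x * f = x * g * star x := fun g => by rw [mul_assoc, hxf]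
  have hfxg : ∀ g, f * (x * g * star x) = x * g * star x := fun g => by
    simp only [← mul_assoc, hfx]
  have hk1 : ∀ g, IsStarProjection g → g * e = g → IsStarProjection (k g) := fun g hg hge =>
    isStarProjection_sub (isStarProjection_conj hx hg hge) hf (hxgf g)
  have hkf : ∀ g, k g * f = k g := fun g => by rw [hk]; simp only [sub_mul, hf.mul_self, hxgf]
  have hyge : ∀ g, y * g * star y * e = y * g * star y := fun g => by rw [mul_assoc, hye]
  have hF1 : ∀ g, IsStarProjection g → g * e = g → IsStarProjection (F g) := fun g hg hge =>
    isStarProjection_sub (isStarProjection_conj hy (hk1 g hg hge) (hkf g)) he (hyge _)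
  have hFe : ∀ g, F g * e = F g := fun g => by rw [hF]; simp only [sub_mul, he.mul_self, hyge]
  have hmono : ∀ g g', g * e = g → g * g' = g → F g * F g' = F g := fun g g' hge hgg' => by
    have h1 : k g * k g' = k g' := by
      rw [hk]
      simp only [sub_mul, mul_sub, hf.mul_self, hfxg, hxgf, conj_mul_conj hx hge, hgg']
      abel
    have h2 : e * (y * k g' * star y) = y * k g' * star y := by simp only [← mul_assoc, hey]
    rw [hF]
    simp only [sub_mul, mul_sub, he.mul_self, hyge, conj_mul_conj hy (hkf g), h1, h2]
    abel
  obtain ⟨s, hs⟩ := exists_isSup fun g : {g : A // IsStarProjection g ∧ g * e = g ∧ g * F g = g} =>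
    g.1
  have hse : s * e = s := hs.le fun g => g.2.2.1
  have hsF : s * F s = s := hs.le fun g => by
    rw [← g.2.2.2, mul_assoc, hmono g s g.2.2.1 (hs.mul_eq g)]
  have hFs := hF1 s hs.isStarProjection hse
  have hsP := hs.isStarProjection
  have hFss : F s * s = F s := hs.mul_eq ⟨F s, hFs, hFe s, hmono s _ hse hsF⟩
  have hfix : F s = s := by
    rw [← hFss]; exact mul_comm_of_mul_eq_left hsP hFs hsF
  have hyk : y * k s * star y = e - s := by
    have : e - y * k s * star y = s := hfix
    exact eq_sub_of_add_eq (by rw [add_comm]; exact (sub_eq_iff_eq_add.mp this).symm)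
  have hkP := hk1 s hsP hse
  have hes := mul_comm_of_mul_eq_left hsP he hse
  have hks : k s * (x * s) = 0 := by
    rw [hk]
    simp only [sub_mul]
    rw [← mul_assoc f, hfx, mul_assoc (x * s), mul_mul_of_mul_eq hx, hes, mul_assoc, hsP.mul_self,
      sub_self]
  have hsk : s * (star x * k s) = 0 := by
    simpa [hkP.star_eq, hsP.star_eq, mul_assoc] using star_mul_eq hks
  have hsy : s * (y * k s) = 0 := by
    have h1 : y * k s * star y * (y * k s) = y * k s := by
      rw [mul_assoc, mul_mul_of_mul_eq hy, mul_comm_of_mul_eq_left hkP hf (hkf s), mul_assoc,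
        hkP.mul_self]
    rw [← h1, hyk, mul_mul_of_mul_eq (c := 0) (by rw [mul_sub, hse, hsP.mul_self, sub_self]),
      zero_mul]
  have hky : k s * (star y * s) = 0 := by
    simpa [hkP.star_eq, hsP.star_eq, mul_assoc] using star_mul_eq hsy
  have hfk := mul_comm_of_mul_eq_left hkP hf (hkf s)
  refine ⟨s * star x + y * k s, ?_, ?_⟩
  · simp only [star_add, star_mul, star_star, hsP.star_eq, hkP.star_eq, add_mul, mul_add,
      mul_assoc, mul_mul_of_mul_eq hx, hes, hsP.mul_self, mul_mul_of_mul_eq hkP.mul_self, hks]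
    have h1 : s * (star x * (k s * star y)) = 0 := by
      rw [← mul_assoc (star x), ← mul_assoc, hsk, zero_mul]
    rw [h1, ← mul_assoc y, hyk, mul_zero]
    abel
  · simp only [star_add, star_mul, star_star, hsP.star_eq, hkP.star_eq, add_mul, mul_add,
      mul_assoc, mul_mul_of_mul_eq hsP.mul_self, mul_mul_of_mul_eq hy, hfk, hkP.mul_self]
    have h1 : k s * (star y * (s * star x)) = 0 := by
      rw [← mul_assoc (star y), ← mul_assoc, hky, zero_mul]
    have h2 : x * (s * star x) = f - k s := by rw [hk]; simp only [mul_assoc, sub_sub_cancel]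
    rw [h1, hsy, h2, mul_zero]
    abel

/-- Additivity of subequivalence for families below a halved projection. -/
theorem sub_of_isSup_of_halved [IsAWStarAlgebra A] {ι : Type*} {q s t : A} {e f : ι → A}
    (hq : IsStarProjection q) (hh : Halved q)
    (he : ∀ i, IsStarProjection (e i)) (hf : ∀ i, IsStarProjection (f i))
    (heo : Pairwise fun i j => e i * e j = 0) (hfo : Pairwise fun i j => f i * f j = 0)
    (hs : IsSup e s) (ht : IsSup f t) (hsq : s * q = s) (htq : t * q = t)
    (h : ∀ i, Sub (e i) (f i)) : Sub s t := by
  obtain ⟨x, y, hx, hy, hxy, -, -⟩ := hh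
  have heq : ∀ i, e i * q = e i := fun i => by rw [← hs.mul_eq, mul_assoc, hsq]
  have hfq : ∀ i, f i * q = f i := fun i => by rw [← ht.mul_eq, mul_assoc, htq]
  -- `x` and `y` move the two families into orthogonal copies of `q`, where orthogonal additivity
  -- applies.
  have key := sub_of_isSup_of_mul_eq_zero (e := fun i => x * e i * star x)
    (f := fun i => y * f i * star y) (fun i => isStarProjection_conj hx (he i) (heq i))
    (fun i => isStarProjection_conj hy (hf i) (hfq i))
    (fun i j hij => by simp only [conj_mul_conj hx (heq i), heo hij, mul_zero, zero_mul])
    (fun i j hij => by simp only [conj_mul_conj hy (hfq i), hfo hij, mul_zero, zero_mul])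
    (hs.conj he hq hsq hx) (ht.conj hf hq htq hy)
    (by
      simp only [mul_assoc]
      rw [mul_mul_of_mul_eq hxy]
      simp)
    (fun i => (sub_conj hx hq (he i) (heq i)).2.trans
      ((h i).trans (sub_conj hy hq (hf i) (hfq i)).1))
  exact (sub_conj hx hq hs.isStarProjection hsq).1.trans
    (key.trans (sub_conj hy hq ht.isStarProjection htq).2)

end SchroederBernstein

/-! ### Maximal abelian subalgebras and their projections. -/

section MaximalAbelian

variable {A : Type*} [CStarAlgebra A] {C : StarSubalgebra ℂ A}

theorem IsMaximalAbelian.mul_comm (hC : IsMaximalAbelian C) {x y : A} (hx : x ∈ C) (hy : y ∈ C) :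
    x * y = y * x := hC.prop x hx y hy

/-- Adjoining `y` to `C` keeps the generators commuting and closed under `star`, so the generated
⋆-algebra is commutative and maximality applies. -/
theorem IsMaximalAbelian.mem_of_isSelfAdjoint (hC : IsMaximalAbelian C) {y : A}
    (hy : IsSelfAdjoint y) (h : ∀ x ∈ C, x * y = y * x) : y ∈ C := by
  set S : Set A := insert y C
  have h1 : ∀ a ∈ S, ∀ b ∈ S, a * b = b * a := by
    rintro a (rfl | ha) b (rfl | hb)
    · rfl
    · exact (h b hb).symm
    · exact h a ha
    · exact hC.mul_comm ha hb
  have h2 : ∀ a ∈ S, star a ∈ S := by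
    rintro a (rfl | ha)
    · rw [hy.star_eq]; exact Set.mem_insert _ _
    · exact Set.mem_insert_of_mem _ (star_mem ha)
  have := StarAlgebra.isMulCommutative_adjoin ℂ h1 fun a ha b hb => h1 a ha _ (h2 b hb)
  have h3 : StarAlgebra.adjoin ℂ S ≤ C := hC.le_of_ge
    (fun a ha b hb => congrArg Subtype.val
      (_root_.mul_comm' (⟨a, ha⟩ : StarAlgebra.adjoin ℂ S) ⟨b, hb⟩))
    fun x hx => StarAlgebra.subset_adjoin ℂ S (Set.mem_insert_of_mem _ hx)
  exact h3 (StarAlgebra.subset_adjoin ℂ S (Set.mem_insert _ _))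

/-- A maximal abelian subalgebra contains its commutant. -/
theorem IsMaximalAbelian.mem_of_forall (hC : IsMaximalAbelian C) {y : A}
    (h : ∀ x ∈ C, x * y = y * x) : y ∈ C := by
  have hs : ∀ x ∈ C, x * star y = star y * x := fun x hx => by
    have := congrArg star (h (star x) (star_mem hx))
    simpa using this.symm
  have h1 : (realPart y : A) ∈ C := hC.mem_of_isSelfAdjoint (realPart y).2 fun x hx => by
    simp [realPart_apply_coe, mul_add, add_mul, h x hx, hs x hx]
  have h2 : (imaginaryPart y : A) ∈ C := hC.mem_of_isSelfAdjoint (imaginaryPart y).2 fun x hx => by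
    simp [imaginaryPart_apply_coe, mul_sub, sub_mul, h x hx, hs x hx]
  rw [← realPart_add_I_smul_imaginaryPart y]
  exact add_mem h1 (SMulMemClass.smul_mem _ h2)

theorem IsMaximalAbelian.mem_of_central (hC : IsMaximalAbelian C) {z : A}
    (hz : ∀ a : A, z * a = a * z) : z ∈ C := hC.mem_of_forall fun x _ => (hz x).symm

/-- Since every `e i` commutes with `x ∈ C`, one gets `s x = s x s`; adjoints give `s x = x s`, and
`C` contains its commutant. -/
theorem IsMaximalAbelian.isSup_mem (hC : IsMaximalAbelian C) {ι : Type*} {e : ι → A} {s : A}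
    (hs : IsSup e s) (he : ∀ i, e i ∈ C) : s ∈ C := by
  have key : ∀ x ∈ C, s * x = s * x * s := fun x hx => by
    have := hs.mul_eq_of_forall (x := x) (y := x * s) fun i => by
      rw [hC.mul_comm (he i) hx, ← mul_assoc, hC.mul_comm (he i) hx, mul_assoc, hs.mul_eq]
    rw [mul_assoc]; exact this
  refine hC.mem_of_forall fun x hx => ?_
  have := congrArg star (key _ (star_mem hx))
  simp only [star_mul, star_star, hs.isStarProjection.star_eq] at this
  rw [this, ← mul_assoc, ← key x hx]

/-- A symmetry in `C` that halves the norm bound of a selfadjoint element of `C`. -/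
theorem IsMaximalAbelian.exists_norm_sub_le [IsAWStarAlgebra A] (hC : IsMaximalAbelian C)
    {c : A} (hc : c ∈ C) (hcs : IsSelfAdjoint c) {r : ℝ} (hr : 0 ≤ r) (hcr : ‖c‖ ≤ 2 * r) :
    ∃ e ∈ C, IsStarProjection e ∧ ‖c - r • (2 * e - 1)‖ ≤ r := by
  rcases subsingleton_or_nontrivial A with hA | hA
  · exact ⟨0, zero_mem C, .zero A, by rw [Subsingleton.elim (c - _) 0, norm_zero]; exact hr⟩
  set a := cfc (fun t : ℝ => max t 0) c with ha
  set b := cfc (fun t : ℝ => max (-t) 0) c with hb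
  have hba : b * a = 0 := by
    rw [hb, ha, ← cfc_mul _ _ c (by fun_prop) (by fun_prop), ← cfc_const_zero ℝ c]
    congr 1; ext t
    rcases le_total t 0 with h | h <;> simp [h]
  have hab : c = a - b := by
    conv_lhs => rw [← cfc_id ℝ c]
    rw [hb, ha, ← cfc_sub _ _ c (by fun_prop) (by fun_prop)]
    congr 1; ext t
    rcases le_total t 0 with h | h <;> simp [h]
  have habs : a + b - r • 1 = cfc (fun t : ℝ => max t 0 + max (-t) 0 - r) c := by
    rw [cfc_sub _ _ c (by fun_prop) (by fun_prop), cfc_add c _ _ (by fun_prop) (by fun_prop),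
      cfc_const r c, Algebra.algebraMap_eq_smul_one]
  have hbC : ∀ x ∈ C, x * b = b * x := fun x hx =>
    (Commute.cfc_real (hC.mul_comm hc hx) _).symm
  -- Annihilating the negative part makes `2 e - 1` a sign of `c`: `c = (2 e - 1)|c|`. So `c - r (2
  -- e - 1) = (2 e - 1)(|c| - r)`, of norm at most `r` because `|c| ≤ 2 r`.
  obtain ⟨e, he, hbe, heb⟩ := exists_annihilator {b}
  simp only [Set.mem_singleton_iff, forall_eq] at hbe heb
  have heC : e ∈ C := by
    have key : ∀ x ∈ C, e * (x * e) = x * e := fun x hx => heb _ (by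
      rw [← mul_assoc, ← hbC x hx, mul_assoc, hbe, mul_zero])
    refine hC.mem_of_forall fun x hx => ?_
    have := congrArg star (key _ (star_mem hx))
    simp only [star_mul, star_star, he.star_eq] at this
    rw [← key x hx, ← mul_assoc, this]
  have hea := heb a hba
  have heb0 : e * b = 0 := by
    have hbs : star b = b := (cfc_predicate (R := ℝ) _ c : IsSelfAdjoint b).star_eq
    simpa [he.star_eq, hbs] using star_mul_eq hbe
  have hu : 2 * e - 1 ∈ unitary A := he.two_mul_sub_one_mem_unitary
  have hcu : c - r • (2 * e - 1) = (2 * e - 1) * (a + b - r • 1) := by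
    rw [mul_sub, mul_smul_comm, mul_one]
    congr 1
    rw [hab, sub_mul, one_mul, mul_assoc, mul_add, hea, heb0, two_mul]
    abel
  refine ⟨e, heC, he, ?_⟩
  rw [hcu, CStarRing.norm_mem_unitary_mul _ hu, habs]
  refine norm_cfc_le hr fun t ht => ?_
  have h1 : |t| ≤ 2 * r := by
    have := spectrum.norm_le_norm_of_mem ht
    exact (this.trans hcr)
  rw [Real.norm_eq_abs, abs_le]
  rcases le_total t 0 with h | h
  · rw [abs_of_nonpos h] at h1
    simp only [max_eq_right h, max_eq_left (neg_nonneg.mpr h)]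
    constructor <;> linarith
  · rw [abs_of_nonneg h] at h1
    simp only [max_eq_left h, max_eq_right (neg_nonpos.mpr h)]
    constructor <;> linarith

/-- An element commuting with the projections of `C` belongs to `C`. -/
theorem IsMaximalAbelian.mem_of_forall_projection [IsAWStarAlgebra A]
    (hC : IsMaximalAbelian C) {y : A}
    (hy : ∀ e ∈ C, IsStarProjection e → e * y = y * e) : y ∈ C := by
  -- Subtracting a multiple of a symmetry from `C` halves the bound on `c` and leaves its commutator
  -- with `y` unchanged.
  have key : ∀ n : ℕ, ∀ r : ℝ, 0 ≤ r → ∀ c ∈ C, IsSelfAdjoint c → ‖c‖ ≤ r →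
      ‖c * y - y * c‖ ≤ 2 * (r / 2 ^ n) * ‖y‖ := by
    intro n
    induction n with
    | zero =>
      intro r hr c _ _ hcr
      calc ‖c * y - y * c‖ ≤ ‖c‖ * ‖y‖ + ‖y‖ * ‖c‖ :=
            (norm_sub_le _ _).trans (add_le_add (norm_mul_le _ _) (norm_mul_le _ _))
        _ = 2 * ‖c‖ * ‖y‖ := by ring
        _ ≤ 2 * (r / 2 ^ 0) * ‖y‖ := by rw [pow_zero, div_one]; gcongr
    | succ n ih =>
      intro r hr c hc hcs hcr
      obtain ⟨e, heC, he, hle⟩ := hC.exists_norm_sub_le hc hcs (r := r / 2) (by positivity)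
        (by linarith)
      have hsa : IsSelfAdjoint ((r / 2) • (2 * e - 1)) := by
        refine IsSelfAdjoint.smul (IsSelfAdjoint.all _) (IsSelfAdjoint.sub ?_ (.one A))
        rw [two_mul]; exact he.isSelfAdjoint.add he.isSelfAdjoint
      have hmem : (r / 2) • (2 * e - 1) ∈ C := by
        have : (((r / 2 : ℝ) : ℂ)) • (2 * e - 1) ∈ C := SMulMemClass.smul_mem _
          (sub_mem (by rw [two_mul]; exact add_mem heC heC) (one_mem C))
        rwa [Complex.coe_smul] at this
      have h1 := ih (r / 2) (by positivity) _ (sub_mem hc hmem) (hcs.sub hsa) hle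
      have h2 : (c - (r / 2) • (2 * e - 1)) * y - y * (c - (r / 2) • (2 * e - 1)) =
          c * y - y * c := by
        have h3 : (2 * e - 1) * y = y * (2 * e - 1) := by
          simp only [two_mul, sub_mul, mul_sub, add_mul, mul_add, hy e heC he, one_mul, mul_one]
        rw [sub_mul, mul_sub, smul_mul_assoc, mul_smul_comm, h3]; abel
      rw [h2] at h1
      refine h1.trans (le_of_eq ?_)
      rw [pow_succ, div_div, mul_comm' 2]
      ring
  have hsa : ∀ c ∈ C, IsSelfAdjoint c → c * y = y * c := fun c hc hcs => by
    rw [← sub_eq_zero, ← norm_le_zero_iff]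
    have hlim : Filter.Tendsto (fun n : ℕ => 2 * (‖c‖ / 2 ^ n) * ‖y‖) Filter.atTop (nhds 0) := by
      have := (tendsto_pow_atTop_nhds_zero_of_lt_one (r := (1 / 2 : ℝ)) (by norm_num)
        (by norm_num)).const_mul (2 * ‖c‖ * ‖y‖)
      rw [mul_zero] at this
      refine this.congr fun n => ?_
      rw [one_div, inv_pow]; ring
    exact ge_of_tendsto' hlim fun n => key n ‖c‖ (norm_nonneg _) c hc hcs le_rfl
  refine hC.mem_of_forall fun x hx => ?_
  have h1 : (realPart x : A) ∈ C := by
    rw [realPart_apply_coe]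
    have : ((2⁻¹ : ℝ) : ℂ) • (x + star x) ∈ C :=
      SMulMemClass.smul_mem _ (add_mem hx (star_mem hx))
    rwa [Complex.coe_smul] at this
  have h2 : (imaginaryPart x : A) ∈ C := by
    rw [imaginaryPart_apply_coe]
    have : -Complex.I • ((2⁻¹ : ℝ) : ℂ) • (x - star x) ∈ C :=
      SMulMemClass.smul_mem _ (SMulMemClass.smul_mem _ (sub_mem hx (star_mem hx)))
    rwa [Complex.coe_smul] at this
  rw [← realPart_add_I_smul_imaginaryPart x, add_mul, mul_add, hsa _ h1 (realPart x).2,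
    smul_mul_assoc, mul_smul_comm, hsa _ h2 (imaginaryPart x).2]

/-- An infinite projection of `C` splits in `C` into two projections that are not centrally
disjoint. -/
theorem IsMaximalAbelian.exists_mul_mul_ne_zero [IsAWStarAlgebra A] (hC : IsMaximalAbelian C)
    {q : A} (hqC : q ∈ C) (hq : IsStarProjection q) (hinf : ¬ IsFiniteProj q) :
    ∃ f ∈ C, IsStarProjection f ∧ f * q = f ∧ ∃ a, f * a * (q - f) ≠ 0 := by
  by_contra! hcon
  apply hinf
  -- If every `f A (q - f)` vanishes, `q A q` commutes with the projections of `C`, so it lies in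
  -- `C` and is commutative. Then `v v⋆ = v⋆ v` there, and `q` is finite.
  have hmem : ∀ y : A, q * y = y → y * q = y → y ∈ C := fun y hqy hyq => by
    refine hC.mem_of_forall_projection fun e heC he => ?_
    have heq := hC.mul_comm heC hqC
    have hP := isStarProjection_mul he hq heq
    have h1 := hcon (e * q) (mul_mem heC hqC) hP (by rw [mul_assoc, hq.mul_self])
    have h4 : e * y = e * q * y := by rw [mul_assoc, hqy]
    have h5 : y * e = y * (e * q) := by rw [heq, ← mul_assoc, hyq]
    rw [h4, h5]
    generalize e * q = f at hP h1
    have h2 := h1 y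
    have h3 := congrArg star (h1 (star y))
    simp only [star_mul, star_sub, star_star, star_zero, hP.star_eq, hq.star_eq] at h3
    rw [mul_sub, sub_eq_zero, mul_assoc, hyq] at h2
    rw [sub_mul, sub_eq_zero, ← mul_assoc, hqy] at h3
    rw [h2, h3, mul_assoc]
  intro f hf ⟨v, hv1, hv2⟩ hfq
  have hvf := mul_eq_self_of_star_mul_self hf hv2.symm
  have hvq : v * q = v := by
    rw [← hvf, mul_assoc, ← hfq]
  have hqv : q * v = v := by
    have := mul_eq_self_of_star_mul_self (v := star v) hq (by simp [hv1])
    simpa [hq.star_eq] using congrArg star this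
  have hvC := hmem v hqv hvq
  rw [hv1, hv2, hC.mul_comm hvC (star_mem hvC)]

end MaximalAbelian

/-! ### Strict pairs, the minimal cover and the splitting of the unit. -/

section Main

variable {A : Type u} [CStarAlgebra A] {C : StarSubalgebra ℂ A}

/-- A pair `e ≤ p ≤ q` of projections of `C` such that `p` is not dominated by `e` on any central
projection that meets `e`. -/
structure StrictPair (C : StarSubalgebra ℂ A) (q p e : A) : Prop where
  left_mem : p ∈ C
  right_mem : e ∈ C
  left_proj : IsStarProjection p
  right_proj : IsStarProjection e
  ne_zero : e ≠ 0
  halved : Halved e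
  right_le_left : e * p = e
  left_le : p * q = p
  not_sub : ∀ z, IsStarProjection z → (∀ a, z * a = a * z) → z * e ≠ 0 → ¬ Sub (z * p) (z * e)

theorem StrictPair.central_mul (hC : IsMaximalAbelian C) {q p e z : A} (h : StrictPair C q p e)
    (hz : IsStarProjection z) (hzc : ∀ a, z * a = a * z) (h0 : z * e ≠ 0) :
    StrictPair C q (z * p) (z * e) where
  left_mem := mul_mem (hC.mem_of_central hzc) h.left_mem
  right_mem := mul_mem (hC.mem_of_central hzc) h.right_mem
  left_proj := isStarProjection_mul hz h.left_proj (hzc _)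
  right_proj := isStarProjection_mul hz h.right_proj (hzc _)
  ne_zero := h0
  halved := h.halved.central_mul hz hzc
  right_le_left := by rw [central_mul_mul hz hzc, h.right_le_left]
  left_le := by rw [mul_assoc, h.left_le]
  not_sub z' hz' hzc' h0' := by
    rw [← mul_assoc, ← mul_assoc] at *
    exact h.not_sub _ (isStarProjection_mul hz' hz (hzc' _)) (central_mul_central hzc' hzc) h0'

variable [IsAWStarAlgebra A]

/-- A central cut makes the smaller part `e` halved, so the larger part `e'` absorbs it: `e + e' ≲
e'`. With `p = e + e'`, half of a splitting is thus present on every central cut, and `hno` forbids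
the other half, `p ≲ e`. -/
theorem exists_strictPair_of_sub (hC : IsMaximalAbelian C)
    (hinf : ∀ q ∈ C, IsStarProjection q → q ≠ 0 → ¬ IsFiniteProj q) {Q : A}
    (hno : ∀ e ∈ C, ∀ p ∈ C, IsStarProjection e → IsStarProjection p → e ≠ 0 → e * p = e →
      p * Q = p → Sub p e → ¬ Sub p (p - e))
    {f f' z : A} (hfC : f ∈ C) (hfC' : f' ∈ C) (hf : IsStarProjection f)
    (hf' : IsStarProjection f') (hff : f * f' = 0) (hfQ : (f + f') * Q = f + f')
    (hz : IsStarProjection z) (hzc : ∀ a, z * a = a * z) (h0 : z * f ≠ 0)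
    (hs : Sub (z * f) (z * f')) :
    ∃ z e : A, IsStarProjection z ∧ (∀ a, z * a = a * z) ∧ StrictPair C Q (z * (f + f')) e := by
  have hP := isStarProjection_mul hz hf (hzc _)
  have hP' := isStarProjection_mul hz hf' (hzc _)
  have hzC := hC.mem_of_central hzc
  obtain ⟨y, hy, hyc, hy0, hyh⟩ := exists_central_halved hP (hinf _ (mul_mem hzC hfC) hP h0)
  have hyC := hC.mem_of_central hyc
  set e := y * (z * f) with he
  set e' := y * (z * f') with he'
  have hsum : y * z * (f + f') = e + e' := by rw [he, he']; simp only [mul_add, mul_assoc]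
  have heP : IsStarProjection e := isStarProjection_mul hy hP (hyc _)
  have heP' : IsStarProjection e' := isStarProjection_mul hy hP' (hyc _)
  have hee : e * e' = 0 := by
    rw [he, he', central_mul_mul hy hyc, central_mul_mul hz hzc, hff, mul_zero, mul_zero]
  have hadd : Sub (e + e') e' := Sub.add_of_halved_left heP heP' hyh (hs.central_mul hy hyc)
  have heC : e ∈ C := mul_mem hyC (mul_mem hzC hfC)
  have heC' : e' ∈ C := mul_mem hyC (mul_mem hzC hfC')
  have hpP := isStarProjection_add heP heP' hee
  have hep : e * (e + e') = e := by rw [mul_add, heP.mul_self, hee, add_zero]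
  have hpQ : (e + e') * Q = e + e' := by rw [← hsum, mul_assoc, hfQ]
  refine ⟨y * z, e, isStarProjection_mul hy hz (hyc _), central_mul_central hyc hzc, ?_⟩
  rw [hsum]
  refine ⟨add_mem heC heC', heC, hpP, heP, hy0, hyh, hep, hpQ, fun x hx hxc hx0 hxs => ?_⟩
  have hxC := hC.mem_of_central hxc
  refine hno (x * e) (mul_mem hxC heC) (x * (e + e')) (mul_mem hxC (add_mem heC heC'))
    (isStarProjection_mul hx heP (hxc _)) (isStarProjection_mul hx hpP (hxc _)) hx0
    (by rw [central_mul_mul hx hxc, hep]) (by rw [mul_assoc, hpQ]) hxs ?_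
  rw [← mul_sub, add_sub_cancel_left]
  exact hadd.central_mul hx hxc

theorem exists_strictPair (hC : IsMaximalAbelian C)
    (hinf : ∀ q ∈ C, IsStarProjection q → q ≠ 0 → ¬ IsFiniteProj q) {Q : A}
    (hno : ∀ e ∈ C, ∀ p ∈ C, IsStarProjection e → IsStarProjection p → e ≠ 0 → e * p = e →
      p * Q = p → Sub p e → ¬ Sub p (p - e))
    {q : A} (hqC : q ∈ C) (hq : IsStarProjection q) (hqQ : q * Q = q) (hq0 : q ≠ 0) :
    ∃ z e : A, IsStarProjection z ∧ (∀ a, z * a = a * z) ∧ StrictPair C Q (z * q) e := by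
  obtain ⟨f, hfC, hf, hfq, a, ha⟩ := hC.exists_mul_mul_ne_zero hqC hq (hinf q hqC hq hq0)
  have hfP' := isStarProjection_sub hf hq hfq
  have hff : f * (q - f) = 0 := by rw [mul_sub, hfq, hf.mul_self, sub_self]
  have hff' := mul_eq_zero_comm hf hfP' hff
  obtain ⟨z, hz, hzc, hz1, hz2⟩ := exists_central_sub_sub hf hfP' hff
  have hfC' := sub_mem hqC hfC
  -- If `z f = 0`, the nonzero corner `f A (q - f)` lives over `1 - z`, and `f` and `q - f` exchange
  -- roles.
  by_cases h0 : z * f = 0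
  · have hzc' : ∀ b, (1 - z) * b = b * (1 - z) := fun b => by rw [one_sub_mul, mul_one_sub, hzc]
    have h1 : (1 - z) * (q - f) ≠ 0 := fun h => ha (by
      have h2 : z * (f * a * (q - f)) = 0 := by simp only [← mul_assoc, h0, zero_mul]
      have h3 : (1 - z) * (f * a * (q - f)) = 0 := by rw [hzc', mul_assoc, ← hzc', h, mul_zero]
      rwa [one_sub_mul, h2, sub_zero] at h3)
    have := exists_strictPair_of_sub hC hinf hno hfC' hfC hfP' hf hff' (by simpa using hqQ)
      hz.one_sub hzc' h1 hz2
    simpa using this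
  · have := exists_strictPair_of_sub hC hinf hno hfC hfC' hf hfP' hff (by simpa using hqQ)
      hz hzc h0 hz1
    simpa using this

/-- Below every projection `q` of `C` there are a central cut `z q` and a strict pair `(z q, e)`
such that `z q` contains an infinite family of orthogonal copies of `e` and is covered by as many
projections dominated by `e`. -/
theorem exists_strictPair_cover (hC : IsMaximalAbelian C)
    (hinf : ∀ q ∈ C, IsStarProjection q → q ≠ 0 → ¬ IsFiniteProj q) {Q : A}
    (hno : ∀ e ∈ C, ∀ p ∈ C, IsStarProjection e → IsStarProjection p → e ≠ 0 → e * p = e →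
      p * Q = p → Sub p e → ¬ Sub p (p - e))
    {q : A} (hqC : q ∈ C) (hq : IsStarProjection q) (hqQ : q * Q = q) (hq0 : q ≠ 0) :
    ∃ (z e : A) (J : Type u) (_ : Infinite J) (g : J → A) (k : Option J → A),
      IsStarProjection z ∧ (∀ a, z * a = a * z) ∧ StrictPair C Q (z * q) e ∧
      (∀ j, IsStarProjection (g j)) ∧ (Pairwise fun i j => g i * g j = 0) ∧
      (∀ j, Sub e (g j)) ∧ (∀ j, g j * (z * q) = g j) ∧
      (∀ j, IsStarProjection (k j)) ∧ (Pairwise fun i j => k i * k j = 0) ∧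
      (∀ j, Sub (k j) e) ∧ IsSup k (z * q) := by
  obtain ⟨z, e, hz, hzc, hpair⟩ := exists_strictPair hC hinf hno hqC hq hqQ hq0
  have he := hpair.right_proj
  obtain ⟨x, y, hx, hy, hxy, hex, hey⟩ := hpair.halved
  have hyx : star y * x = 0 := by simpa using star_mul_eq hxy
  have hye := mul_eq_self_of_star_mul_self he hy
  have hey' : e * star y = star y := by simpa [he.star_eq] using star_mul_eq hye
  have hye' : star y * e = star y := by simpa [he.star_eq] using star_mul_eq hey
  have hf0 : y * star y ≠ 0 := fun h => hpair.ne_zero (by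
    rw [← hy, CStarRing.mul_star_self_eq_zero_iff _ |>.mp h, mul_zero])
  -- The halving of `e` supplies both the shift `x` and the wandering projection `y y⋆`, itself a
  -- copy of `e`. In the cover, `none` will index the remainder.
  obtain ⟨J, hJ, g, s, w, hg, hgf, hfg, hgo, hgq, hs, hw, hwc, hw0, hws⟩ :=
    exists_copies (q := z * q) (e := e) (f₀ := y * star y) (x := x) hpair.left_proj he
      (isStarProjection_mul_star he hy) hpair.right_le_left hx hex (by rw [mul_assoc, hye'])
      (by rw [mul_assoc, hyx, mul_zero]) hf0
  have hfe : Sub (y * star y) e := ⟨star y, by rw [star_star], hey'⟩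
  have hef : Sub e (y * star y) := ⟨y, hy, by rw [mul_assoc, hy, hye]⟩
  have hwe0 : w * e ≠ 0 := fun h => hw0 (Sub.eq_zero (h ▸ hfe.central_mul hw hwc))
  have hsq : s * (z * q) = s := hs.le hgq
  have hr := isStarProjection_sub hs.isStarProjection hpair.left_proj hsq
  have hsr : s * (z * q - s) = 0 := by rw [mul_sub, hsq, hs.isStarProjection.mul_self, sub_self]
  have hgr : ∀ j, g j * (z * q - s) = 0 := fun j => by rw [mul_sub, hgq, hs.mul_eq, sub_self]
  have hrg : ∀ j, (z * q - s) * g j = 0 := fun j => mul_eq_zero_comm (hg j) hr (hgr j)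
  refine ⟨w * z, w * e, J, hJ, fun j => w * g j,
    fun o => o.elim (w * (z * q - s)) fun j => w * g j, isStarProjection_mul hw hz (hwc _),
    central_mul_central hwc hzc, ?_, fun j => isStarProjection_mul hw (hg j) (hwc _), ?_, ?_, ?_,
    ?_, ?_, ?_, ?_⟩
  · rw [mul_assoc]; exact hpair.central_mul hC hw hwc hwe0
  · exact fun i j h => by simp only [central_mul_mul hw hwc, hgo h, mul_zero]
  · exact fun j => (hef.trans (hfg j)).central_mul hw hwc
  · exact fun j => by rw [mul_assoc w z, central_mul_mul hw hwc, hgq]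
  · rintro (_ | j)
    · exact isStarProjection_mul hw hr (hwc _)
    · exact isStarProjection_mul hw (hg j) (hwc _)
  · rintro (_ | i) (_ | j) h
    · exact absurd rfl h
    · simp only [Option.elim, central_mul_mul hw hwc, hrg, mul_zero]
    · simp only [Option.elim, central_mul_mul hw hwc, hgr, mul_zero]
    · simp only [Option.elim, central_mul_mul hw hwc, hgo fun h' => h (congrArg some h'),
        mul_zero]
  · rintro (_ | j)
    · exact hws.trans (hfe.central_mul hw hwc)
    · exact ((hgf j).trans hfe).central_mul hw hwc
  · have := isSup_option (hs.central_mul hw hwc) (isStarProjection_mul hw hr (hwc _))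
      (by rw [central_mul_mul hw hwc, hsr, mul_zero])
    rwa [← mul_add, add_sub_cancel, ← mul_assoc] at this

/-- The extra index for the remainder costs nothing, since `J` is infinite. -/
theorem exists_prod_option_embedding {I J : Type u} [Infinite J]
    (h : Cardinal.mk I ≤ Cardinal.mk (Option J)) : Nonempty (I × Option J ↪ J) := by
  refine Cardinal.le_def _ _ |>.mp ?_
  have hJ : Cardinal.aleph0 ≤ Cardinal.mk J := Cardinal.infinite_iff.mp ‹_›
  have h1 : Cardinal.mk (Option J) = Cardinal.mk J := by
    rw [Cardinal.mk_option, Cardinal.add_one_eq hJ]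
  rw [h1] at h
  rw [Cardinal.mk_prod, Cardinal.lift_id, Cardinal.lift_id, h1]
  calc Cardinal.mk I * Cardinal.mk J ≤ Cardinal.mk J * Cardinal.mk J := mul_le_mul_left h _
    _ = Cardinal.mk J := Cardinal.mul_eq_self hJ

/-- A projection below `q` in `C` that splits in `C` into two copies of itself, when `q` is
halved. -/
theorem exists_splitting_of_halved (hC : IsMaximalAbelian C)
    (hinf : ∀ q ∈ C, IsStarProjection q → q ≠ 0 → ¬ IsFiniteProj q) {Q : A} (hQC : Q ∈ C)
    (hQ : IsStarProjection Q) (hQ0 : Q ≠ 0) (hh : Halved Q) :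
    ∃ e ∈ C, ∃ p ∈ C, IsStarProjection e ∧ IsStarProjection p ∧ e ≠ 0 ∧ e * p = e ∧ p * Q = p ∧
      Sub p e ∧ Sub p (p - e) := by
  by_contra! hno
  -- Cardinalities of orthogonal covers of `p` by pieces dominated by `e`, over all strict pairs
  -- below `Q`.
  let S : Set Cardinal.{u} := {κ | ∃ (p e : A) (I : Type u) (r : I → A), Cardinal.mk I = κ ∧
    StrictPair C Q p e ∧ (∀ i, IsStarProjection (r i)) ∧ (Pairwise fun i j => r i * r j = 0) ∧
    (∀ i, Sub (r i) e) ∧ IsSup r p}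
  have hS : S.Nonempty := by
    obtain ⟨z, e, J, hJ, g, k, hz, hzc, hpair, hg, hgo, heg, hgq, hk, hko, hke, hsup⟩ :=
      exists_strictPair_cover hC hinf hno hQC hQ hQ.mul_self hQ0
    exact ⟨_, z * Q, e, Option J, k, rfl, hpair, hk, hko, hke, hsup⟩
  obtain ⟨κ, ⟨p, e, I, r, rfl, hpair, hr, hro, hre, hrsup⟩, hmin⟩ :=
    WellFounded.has_min Cardinal.lt_wf S hS
  have he := hpair.right_proj
  have heQ : e * Q = e := by rw [← hpair.right_le_left, mul_assoc, hpair.left_le]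
  obtain ⟨z, e₂, J, hJ, g, k, hz, hzc, hpair₂, hg, hgo, heg, hgq, hk, hko, hke, hsup⟩ :=
      exists_strictPair_cover hC hinf hno hpair.right_mem he heQ hpair.ne_zero
  have hze0 : z * e ≠ 0 := fun h => hpair₂.ne_zero (by
    rw [← hpair₂.right_le_left, h, mul_zero])
  -- Minimality gives `|I| ≤ |Option J|`, so `J` contains `I` disjoint blocks, each as large as the
  -- cover of `z e`. Each block supremum `h i` therefore dominates `z e`, hence also `z r i`.
  obtain ⟨φ⟩ := exists_prod_option_embedding (I := I) (J := J)
    (not_lt.mp (hmin _ ⟨z * e, e₂, Option J, k, rfl, hpair₂, hk, hko, hke, hsup⟩))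
  choose h hhsup using fun i : I => exists_isSup fun o => g (φ (i, o))
  have hze : IsStarProjection (z * e) := hpair₂.left_proj
  have hzeQ : z * e * Q = z * e := hpair₂.left_le
  have hhe : ∀ i, h i * (z * e) = h i := fun i => (hhsup i).le fun o => hgq _
  have heh : ∀ i, Sub (z * e) (h i) := fun i =>
    sub_of_isSup_of_halved hQ hh hk (fun _ => hg _) hko
      (fun a b hab => hgo (φ.injective.ne (by simpa using hab))) hsup (hhsup i) hzeQ
      (by rw [← hhe i, mul_assoc, hzeQ]) fun o => (hke o).trans (heg _)
  have hho : Pairwise fun i j => h i * h j = 0 := fun i j hij =>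
    (hhsup i).mul_eq_zero_of_forall (hhsup j) (fun _ => hg _) (fun _ => hg _) fun a b =>
      hgo (φ.injective.ne (by simp [hij]))
  obtain ⟨t, ht⟩ := exists_isSup h
  have hte : t * (z * e) = t := ht.le hhe
  refine hpair.not_sub z hz hzc hze0 (Sub.mono_right (f := t) ?_ ht.isStarProjection hze hte)
  exact sub_of_isSup_of_halved hQ hh (fun i => isStarProjection_mul hz (hr i) (hzc _))
    (fun i => (hhsup i).isStarProjection)
    (fun i j hij => by simp only [central_mul_mul hz hzc, hro hij, mul_zero]) hho
    (hrsup.central_mul hz hzc) ht (by rw [mul_assoc, hpair.left_le])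
    (by rw [← hte, mul_assoc, hzeQ]) fun i => ((hre i).central_mul hz hzc).trans (heh i)

/-- Below every nonzero projection of `C` there is one that splits in `C` into two copies of
itself. -/
theorem exists_splitting (hC : IsMaximalAbelian C)
    (hinf : ∀ q ∈ C, IsStarProjection q → q ≠ 0 → ¬ IsFiniteProj q) {q : A} (hqC : q ∈ C)
    (hq : IsStarProjection q) (hq0 : q ≠ 0) :
    ∃ e ∈ C, ∃ p ∈ C, IsStarProjection e ∧ IsStarProjection p ∧ e ≠ 0 ∧ e * p = e ∧ p * q = p ∧
      Sub p e ∧ Sub p (p - e) := by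
  obtain ⟨z, hz, hzc, hz0, hzh⟩ := exists_central_halved hq (hinf q hqC hq hq0)
  obtain ⟨e, heC, p, hpC, he, hp, he0, hep, hpq, h1, h2⟩ := exists_splitting_of_halved hC hinf
    (mul_mem (hC.mem_of_central hzc) hqC) (isStarProjection_mul hz hq (hzc q)) hz0 hzh
  refine ⟨e, heC, p, hpC, he, hp, he0, hep, ?_, h1, h2⟩
  rw [← hpq, mul_assoc, mul_assoc, hq.mul_self]

/-- The unit splits in `C` into two copies of itself. -/
theorem exists_splitting_one (hC : IsMaximalAbelian C)
    (hinf : ∀ q ∈ C, IsStarProjection q → q ≠ 0 → ¬ IsFiniteProj q) :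
    ∃ e ∈ C, IsStarProjection e ∧ Sub 1 e ∧ Sub 1 (1 - e) := by
  obtain ⟨W, -, hW, hWR, hmax⟩ := exists_maximal_pairwise
    (fun x : A × A => x.1 ∈ C ∧ x.2 ∈ C ∧ IsStarProjection x.1 ∧ IsStarProjection x.2 ∧
      x.2 ≠ 0 ∧ x.1 * x.2 = x.1 ∧ Sub x.2 x.1 ∧ Sub x.2 (x.2 - x.1))
    (fun x y => x.2 * y.2 = 0) ∅ (by simp) (by simp)
  choose! hC1 hC2 hP1 hP2 hne hle hsub hsub' using hW
  set e : W → A := fun x => x.1.1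
  set p : W → A := fun x => x.1.2
  have he : ∀ i, IsStarProjection (e i) := fun i => hP1 i i.2
  have hp : ∀ i, IsStarProjection (p i) := fun i => hP2 i i.2
  have hep : ∀ i, e i * p i = e i := fun i => hle i i.2
  have hpe : ∀ i, p i * e i = e i := fun i => mul_comm_of_mul_eq_left (he i) (hp i) (hep i)
  have hd : ∀ i, IsStarProjection (p i - e i) := fun i => isStarProjection_sub (he i) (hp i) (hep i)
  have hpo : Pairwise fun i j => p i * p j = 0 := fun i j h =>
    hWR i.2 j.2 fun h' => h (Subtype.ext h')
  have hdp : ∀ i, (p i - e i) * p i = p i - e i := fun i => by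
    rw [sub_mul, (hp i).mul_self, hep]
  have hpd : ∀ i, p i * (p i - e i) = p i - e i := fun i =>
    mul_comm_of_mul_eq_left (hd i) (hp i) (hdp i)
  have horth : ∀ {i j : W} {a b : A}, i ≠ j → a * p i = a → p j * b = b → a * b = 0 :=
    fun {i j a b} hij ha hb => by
      have h1 : p i * p j = 0 := hpo hij
      rw [← ha, ← hb, mul_assoc, mul_mul_of_mul_eq h1, zero_mul, mul_zero]
  obtain ⟨s, hs⟩ := exists_isSup p
  have hs1 : s = 1 := by
    by_contra hs1
    obtain ⟨e', heC, p', hpC, he', hp', he0, hep', hps, h1, h2⟩ := exists_splitting hC hinf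
      (sub_mem (one_mem C) (hC.isSup_mem hs fun i => hC2 i i.2)) hs.isStarProjection.one_sub
      (sub_ne_zero.mpr (Ne.symm hs1))
    have hps0 : p' * s = 0 := by
      rw [mul_sub, mul_one, sub_eq_self] at hps
      exact hps
    have hp0 : p' ≠ 0 := fun h => he0 (by rw [← hep', h, mul_zero])
    have hmem : (e', p') ∈ W := by
      refine hmax _ ⟨heC, hpC, he', hp', hp0, hep', h1, h2⟩ fun w hw => ?_
      have h3 : w.2 * p' = 0 := by
        have h4 : w.2 * s = w.2 := hs.mul_eq ⟨w, hw⟩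
        rw [← h4, mul_assoc, mul_eq_zero_comm hp' hs.isStarProjection hps0, mul_zero]
      exact ⟨h3, mul_eq_zero_comm (hP2 w hw) hp' h3⟩
    have h4 : p' * s = p' := hs.mul_eq ⟨_, hmem⟩
    exact hp0 (by rw [← h4, hps0])
  obtain ⟨E, hE⟩ := exists_isSup e
  obtain ⟨D, hD⟩ := exists_isSup fun i => p i - e i
  have hed : ∀ i j, e i * (p j - e j) = 0 := fun i j => by
    by_cases hij : i = j
    · subst hij
      rw [mul_sub, hep, (he i).mul_self, sub_self]
    · exact horth hij (hep i) (hpd j)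
  have hED : E * D = 0 := hE.mul_eq_zero_of_forall hD he hd hed
  have hDE := mul_eq_zero_comm hE.isStarProjection hD.isStarProjection hED
  have hsum : E + D = 1 := by
    have h1 : s * (E + D) = s := hs.le fun i => by
      have h2 : e i * D = 0 := by rw [← hE.mul_eq i, mul_assoc, hED, mul_zero]
      have h3 : (p i - e i) * E = 0 := by rw [← hD.mul_eq i, mul_assoc, hDE, mul_zero]
      calc p i * (E + D) = e i * E + e i * D + ((p i - e i) * E + (p i - e i) * D) := by
            rw [← mul_add, ← mul_add, ← add_mul, add_sub_cancel]
        _ = p i := by rw [h2, h3, hE.mul_eq, hD.mul_eq]; abel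
    rwa [hs1, one_mul] at h1
  have heo : Pairwise fun i j => e i * e j = 0 := fun i j h => horth h (hep i) (hpe j)
  have hdo : Pairwise fun i j => (p i - e i) * (p j - e j) = 0 := fun i j h =>
    horth h (hdp i) (hpd j)
  have hSub : ∀ i, Sub (p i) (e i) := fun i => hsub i i.2
  have hSub' : ∀ i, Sub (p i) (p i - e i) := fun i => hsub' i i.2
  have hSED : Sub E D := sub_of_isSup_of_mul_eq_zero he hd heo hdo hE hD hED fun i =>
    (Sub.of_le (he i) (hp i) (hep i)).trans (hSub' i)
  choose v hv hev using hSub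
  have hve : ∀ i, star (v i) * e i = star (v i) := fun i => by
    simpa [(he i).star_eq] using star_mul_eq (hev i)
  have hvp : ∀ i, star (v i) * p i = star (v i) := fun i => by rw [← hve i, mul_assoc, hep]
  have hvE : ∀ i, star (v i) * E = star (v i) := fun i => by rw [← hve i, mul_assoc, hE.mul_eq]
  -- `v i` embeds `p i` in `e i`, carrying `e i` and `p i - e i` to projections below `E`. These are
  -- orthogonal to `D`, so orthogonal additivity embeds `D` in their suprema without `1` being
  -- halved.
  have hcopy : ∀ c : W → A, (∀ i, IsStarProjection (c i)) → (∀ i, c i * p i = c i) →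
      (∀ i, Sub (p i) (c i)) → ∀ B, IsSup (fun i => v i * c i * star (v i)) B →
      Sub D B ∧ B * E = B := fun c hc hcp hpc B hB => by
    have hBE : B * E = B := hB.le fun i => by
      rw [mul_assoc, hvE]
    refine ⟨sub_of_isSup_of_mul_eq_zero hd (fun i => isStarProjection_conj (hv i) (hc i) (hcp i))
      hdo (fun i j hij => ?_) hD hB ?_ fun i => ?_, hBE⟩
    · refine horth hij ?_ ?_
      · rw [mul_assoc, hvp]
      · rw [← hev j]; simp only [← mul_assoc, hpe]
    · rw [← mul_comm_of_mul_eq_left hB.isStarProjection hE.isStarProjection hBE,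
        mul_mul_of_mul_eq hDE, zero_mul]
    · exact (Sub.of_le (hd i) (hp i) (hdp i)).trans
        ((hpc i).trans (sub_conj (hv i) (hp i) (hc i) (hcp i)).1)
  obtain ⟨B₁, hB₁⟩ := exists_isSup fun i => v i * e i * star (v i)
  obtain ⟨B₂, hB₂⟩ := exists_isSup fun i => v i * (p i - e i) * star (v i)
  obtain ⟨h1, h1'⟩ := hcopy e he hep (fun i => hsub i i.2) B₁ hB₁
  obtain ⟨h2, h2'⟩ := hcopy _ hd hdp hSub' B₂ hB₂
  have hB : B₁ * B₂ = 0 := hB₁.mul_eq_zero_of_forall hB₂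
    (fun i => isStarProjection_conj (hv i) (he i) (hep i))
    (fun i => isStarProjection_conj (hv i) (hd i) (hdp i)) fun i j => by
      by_cases hij : i = j
      · subst hij
        rw [conj_mul_conj (hv i) (hep i), hed, mul_zero, zero_mul]
      · refine horth hij ?_ ?_
        · rw [mul_assoc, hvp]
        · rw [← hev j]; simp only [← mul_assoc, hpe]
  have hBP := isStarProjection_add hB₁.isStarProjection hB₂.isStarProjection hB
  -- `E ≲ D ≲ B₁` and `D ≲ B₂` with `B₁`, `B₂` orthogonal below `E`, so `1 = E + D` fits into `E`.
  have h1E : Sub 1 E := by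
    rw [← hsum]
    exact (Sub.add (hSED.trans h1) h2 hB₁.isStarProjection hB₂.isStarProjection hB).mono_right hBP
      hE.isStarProjection (by rw [add_mul, h1', h2'])
  refine ⟨E, hC.isSup_mem hE fun i => hC1 i i.2, hE.isStarProjection, h1E, ?_⟩
  rw [← hsum, add_sub_cancel_left, hsum]
  exact h1E.trans hSED

end Main

end AWStar

theorem proposition6p1 {A : Type*} [CStarAlgebra A] [IsAWStarAlgebra A]
    (C : StarSubalgebra ℂ A) (hC : AWStar.IsMaximalAbelian C)
    (hinf : ∀ q ∈ C, IsStarProjection q → q ≠ 0 → AWStar.IsProperlyInfinite q) :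
    (Nontrivial A → ∃ e ∈ C, ∃ p ∈ C, IsStarProjection e ∧ IsStarProjection p ∧
      e ≠ 0 ∧ AWStar.ProjLE e p ∧ AWStar.ProjEquiv e p ∧ AWStar.ProjEquiv p (p - e)) ∧
    (∃ e ∈ C, IsStarProjection e ∧ AWStar.ProjEquiv e 1 ∧ AWStar.ProjEquiv 1 (1 - e)) := by
  open AWStar in
  have hinf' : ∀ q ∈ C, IsStarProjection q → q ≠ 0 → ¬ IsFiniteProj q := fun q hqC hq hq0 => by
    have := (hinf q hqC hq hq0).eq_zero_or_infinite 1 (.one A) (by simp)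
    rw [one_mul] at this
    exact this.resolve_left hq0
  refine ⟨fun _ => ?_, ?_⟩
  · obtain ⟨e, heC, p, hpC, he, hp, he0, hep, -, h1, h2⟩ :=
      AWStar.exists_splitting hC hinf' (one_mem C) (.one A) one_ne_zero
    have hd := AWStar.isStarProjection_sub he hp hep
    have hdp : (p - e) * p = p - e := by rw [sub_mul, hp.mul_self, hep]
    exact ⟨e, heC, p, hpC, he, hp, he0, hep.symm, (AWStar.Sub.of_le he hp hep).antisymm he hp h1,
      h2.antisymm hp hd (AWStar.Sub.of_le hd hp hdp)⟩
  · obtain ⟨e, heC, he, h1, h2⟩ := AWStar.exists_splitting_one hC hinf'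
    exact ⟨e, heC, he, (AWStar.Sub.of_le he (.one A) (mul_one e)).antisymm he (.one A) h1,
      h2.antisymm (.one A) he.one_sub (AWStar.Sub.of_le he.one_sub (.one A) (mul_one _))⟩
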